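/- **Setting.** Let $d\in\mathbb N$. Let $\mathbb W_0$ be the Weyl $*$-algebra: the complex vector space with basis the monomials $u_\alpha v_\beta$ ($\alpha,\beta\in\mathbb R^d$), with $$u_\alpha v_\beta=e^{i\alpha\cdot\beta}v_\beta u_\alpha,\quad u_\alpha u_{\alpha'}=u_{\alpha+\alpha'},\quad v_\beta v_{\beta'}=v_{\beta+\beta'},\quad u_\alpha^*=u_{-\alpha},\quad v_\beta^*=v_{-\beta},$$ and let $\mathbb W$ be the Weyl $C^*$-algebra, the completion of $\mathbb W_0$ in the norm $\|a\|=\sup_\rho\|\rho(a)\|$, where $\rho$ runs over the $*$-representations of $\mathbb W_0$ by bounded operators on Hilbert spaces. A state of $\mathbb W$ is a normalized positive linear functional. Let $\mathcal S_{\mathbb W}^\tau$ be the set of states $\omega$ with $\omega(v_\lambda a v_\lambda^*)=\omega(a)$ for all $\lambda\in\mathbb R^d$, $a\in\mathbb W$, with the weak-$*$ topology. Let $\mathfrak b(\mathbb R^d)$ be the Bohr compactification of $\mathbb R^d$, i.e. the compact group of all (not necessarily continuous) characters $\lambda:\mathbb R^d\to\mathbb T$ with the topology of pointwise convergence; for $\beta\in\mathbb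 R^d$ put $\xi_\beta(\lambda)=\lambda(\beta)$. Let $\mathfrak i:\mathbb R^d\to\mathfrak b(\mathbb R^d)$, $\mathfrak i(x)(\beta)=e^{i\beta\cdot x}$, and $\mathbb R^d_{\mathfrak b}=\mathfrak i(\mathbb R^d)$. For a topological space $X$ let $\mathcal M_{+,1}(X)$ be the set of regular Borel probability measures on $X$ with the weak-$*$ topology. **Proposition.** 1. For every $\mu\in\mathcal M_{+,1}(\mathfrak b(\mathbb R^d))$ there is exactly one state $\omega_\mu$ of $\mathbb W$ such that $$\omega_\mu(u_\alpha v_\beta)=\delta_{\alpha,0}\int_{\mathfrak b(\mathbb R^d)}\xi_{-\beta}(\lambda)\,d\mu(\lambda)\qquad(\alpha,\beta\in\mathbb R^d).$$ This state is translation-invariant, and $\mu\mapsto\omega_\mu$ is a homeomorphism $\mathcal M_{+,1}(\mathfrak b(\mathbb R^d))\to\mathcal S_{\mathbb W}^\tau$. 2. The map $\beta\mapsto\omega_\mu(v_\beta)$ is continuous on $\mathbb R^d$ (with its usual topology) if and only if $\mu$ is carried by $\mathbb R^d_{\mathfrak b}$, i.e. $\mu(\mathfrak b(\mathbb R^d)\setminus\mathbb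 R^d_{\mathfrak b})=0$. 3. In that case there is exactly one $\widehat\mu\in\mathcal M_{+,1}(\mathbb R^d)$ with $\widehat\mu(\mathfrak i^{-1}(B))=\mu(B)$ for all Borel sets $B\subseteq\mathfrak b(\mathbb R^d)$, and $$\omega_\mu(u_\alpha v_\beta)=\delta_{\alpha,0}\int_{\mathbb R^d}e^{-i\lambda\cdot\beta}\,d\widehat\mu(\lambda)\qquad(\alpha,\beta\in\mathbb R^d).$$ -/

import Mathlib

open scoped ComplexOrder
open MeasureTheory UniformSpace

noncomputable section

/-! ## The Weyl `*`-algebra -/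

/-- The space `ℝ^d` with its Euclidean inner product. -/
abbrev Vec (d : ℕ) : Type := EuclideanSpace ℝ (Fin d)

/-- The phase `e^{i t}` as a complex number. -/
def phase (t : ℝ) : ℂ := (Circle.exp t : ℂ)

theorem phase_zero : phase 0 = 1 := by simp [phase]

theorem phase_add (s t : ℝ) : phase (s + t) = phase s * phase t := by simp [phase]

theorem star_phase (t : ℝ) : star (phase t) = phase (-t) := by
  rw [phase, phase, Circle.exp_neg, Circle.coe_inv_eq_conj]
  rfl

/-- The Weyl `*`-algebra `W₀`: formal finite complex linear combinations of the monomials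
`u_α v_β`; the monomial `u_α v_β` is the basis vector with index `(α, β)`. -/
def WeylPoly (d : ℕ) : Type := (Vec d × Vec d) →₀ ℂ

namespace WeylPoly

variable {d : ℕ}

instance : AddCommGroup (WeylPoly d) := inferInstanceAs (AddCommGroup ((Vec d × Vec d) →₀ ℂ))

instance : Module ℂ (WeylPoly d) := inferInstanceAs (Module ℂ ((Vec d × Vec d) →₀ ℂ))

/-- The coefficients of an element of `W₀`. -/
def coeffs (f : WeylPoly d) : (Vec d × Vec d) →₀ ℂ := f

/-- `mono z c` is `c u_α v_β` for `z = (α, β)`. -/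
def mono (z : Vec d × Vec d) (c : ℂ) : WeylPoly d := Finsupp.single z c

/-- `u_α v_β u_α' v_β' = e^{-i α'·β} u_{α+α'} v_{β+β'}`, extended bilinearly. -/
instance : Mul (WeylPoly d) where
  mul f g := f.coeffs.sum fun z a => g.coeffs.sum fun w b =>
    mono (z + w) (a * b * phase (-inner ℝ w.1 z.2))

instance : One (WeylPoly d) where
  one := mono 0 1

/-- `(u_α v_β)^* = v_{-β} u_{-α} = e^{-i α·β} u_{-α} v_{-β}`, extended antilinearly. -/
instance : Star (WeylPoly d) where
  star f := f.coeffs.sum fun z a => mono (-z) (star a * phase (-inner ℝ z.1 z.2))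

theorem coeffs_mono (z : Vec d × Vec d) (a : ℂ) : (mono z a).coeffs = Finsupp.single z a := rfl

theorem coeffs_add (f g : WeylPoly d) : (f + g).coeffs = f.coeffs + g.coeffs := rfl

theorem mono_add (z : Vec d × Vec d) (a b : ℂ) : mono z (a + b) = mono z a + mono z b :=
  Finsupp.single_add z a b

theorem mono_zero (z : Vec d × Vec d) : mono z 0 = 0 := Finsupp.single_zero z

theorem smul_mono (c : ℂ) (z : Vec d × Vec d) (a : ℂ) : c • mono z a = mono z (c * a) :=
  Finsupp.smul_single c z a

@[elab_as_elim]
theorem ind {p : WeylPoly d → Prop} (f : WeylPoly d) (h0 : p 0)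
    (hadd : ∀ f g, p f → p g → p (f + g)) (hm : ∀ z a, p (mono z a)) : p f :=
  Finsupp.induction_linear f h0 hadd hm

theorem one_def : (1 : WeylPoly d) = mono 0 1 := rfl

theorem mul_def' (f g : WeylPoly d) : f * g = f.coeffs.sum fun z a => g.coeffs.sum fun w b =>
    mono (z + w) (a * b * phase (-inner ℝ w.1 z.2)) := rfl

theorem star_def' (f : WeylPoly d) : star f =
    f.coeffs.sum fun z a => mono (-z) (star a * phase (-inner ℝ z.1 z.2)) := rfl

theorem mono_mul_mono (z w : Vec d × Vec d) (a b : ℂ) :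
    mono z a * mono w b = mono (z + w) (a * b * phase (-inner ℝ w.1 z.2)) := by
  rw [mul_def', coeffs_mono, coeffs_mono, Finsupp.sum_single_index, Finsupp.sum_single_index]
  · simp [mono_zero]
  · rw [Finsupp.sum_single_index] <;> simp [mono_zero]

theorem star_mono (z : Vec d × Vec d) (a : ℂ) :
    star (mono z a) = mono (-z) (star a * phase (-inner ℝ z.1 z.2)) := by
  rw [star_def', coeffs_mono, Finsupp.sum_single_index]
  simp [mono_zero]

protected theorem add_mul' (f g h : WeylPoly d) : (f + g) * h = f * h + g * h := by
  simp only [mul_def', coeffs_add]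
  refine Finsupp.sum_add_index' (fun z => ?_) (fun z a b => ?_)
  · simp [mono_zero]
  · rw [← Finsupp.sum_add]
    simp only [add_mul, mono_add]

protected theorem mul_add' (f g h : WeylPoly d) : f * (g + h) = f * g + f * h := by
  simp only [mul_def', coeffs_add]
  rw [← Finsupp.sum_add]
  refine Finsupp.sum_congr fun z _ => ?_
  refine Finsupp.sum_add_index' (fun w => ?_) (fun w a b => ?_)
  · simp [mono_zero]
  · simp only [mul_add, add_mul, mono_add]

protected theorem star_add' (f g : WeylPoly d) : star (f + g) = star f + star g := by
  simp only [star_def', coeffs_add]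
  refine Finsupp.sum_add_index' (fun z => ?_) (fun z a b => ?_)
  · simp [mono_zero]
  · simp only [star_add, add_mul, mono_add]

protected theorem zero_mul' (f : WeylPoly d) : 0 * f = 0 := Finsupp.sum_zero_index

protected theorem mul_zero' (f : WeylPoly d) : f * 0 = 0 := by
  have h := WeylPoly.mul_add' f 0 0
  simpa using h

protected theorem star_zero' : star (0 : WeylPoly d) = 0 := Finsupp.sum_zero_index

instance : Ring (WeylPoly d) where
  __ := (inferInstance : AddCommGroup (WeylPoly d))
  left_distrib := WeylPoly.mul_add'
  right_distrib := WeylPoly.add_mul'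
  zero_mul := WeylPoly.zero_mul'
  mul_zero := WeylPoly.mul_zero'
  mul_assoc f g h := by
    induction f using ind with
    | h0 => simp only [WeylPoly.zero_mul']
    | hadd f f' hf hf' => simp only [WeylPoly.add_mul', hf, hf']
    | hm z a =>
      induction g using ind with
      | h0 => simp only [WeylPoly.zero_mul', WeylPoly.mul_zero']
      | hadd f f' hf hf' => simp only [WeylPoly.add_mul', WeylPoly.mul_add', hf, hf']
      | hm w b =>
        induction h using ind with
        | h0 => simp only [WeylPoly.mul_zero']
        | hadd f f' hf hf' => simp only [WeylPoly.mul_add', hf, hf']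
        | hm x c =>
          simp only [mono_mul_mono, Prod.fst_add, Prod.snd_add, inner_add_left, inner_add_right,
            neg_add, phase_add, add_assoc]
          congr 1
          ring
  one_mul f := by
    induction f using ind with
    | h0 => exact WeylPoly.mul_zero' 1
    | hadd f f' hf hf' => rw [WeylPoly.mul_add', hf, hf']
    | hm z a => simp [one_def, mono_mul_mono, phase_zero]
  mul_one f := by
    induction f using ind with
    | h0 => exact WeylPoly.zero_mul' 1
    | hadd f f' hf hf' => rw [WeylPoly.add_mul', hf, hf']
    | hm z a => simp [one_def, mono_mul_mono, phase_zero]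

instance : StarRing (WeylPoly d) where
  star_involutive f := by
    induction f using ind with
    | h0 => simp only [WeylPoly.star_zero']
    | hadd f f' hf hf' => rw [WeylPoly.star_add', WeylPoly.star_add', hf, hf']
    | hm z a =>
      simp only [star_mono, star_mul', star_phase, star_star, Prod.fst_neg, Prod.snd_neg,
        inner_neg_neg, neg_neg, mul_assoc, ← phase_add, add_neg_cancel, phase_zero, mul_one]
  star_mul f g := by
    induction f using ind with
    | h0 => simp only [WeylPoly.star_zero', zero_mul, mul_zero]
    | hadd f f' hf hf' => rw [add_mul, WeylPoly.star_add', WeylPoly.star_add', mul_add, hf, hf']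
    | hm z a =>
      induction g using ind with
      | h0 => simp only [WeylPoly.star_zero', zero_mul, mul_zero]
      | hadd f f' hf hf' => rw [mul_add, WeylPoly.star_add', WeylPoly.star_add', add_mul, hf, hf']
      | hm w b =>
        have key : phase (inner ℝ w.1 z.2) * phase (-inner ℝ (z + w).1 (z + w).2) =
            phase (-inner ℝ w.1 w.2) * phase (-inner ℝ z.1 z.2) * phase (-inner ℝ z.1 w.2) := by
          simp only [← phase_add, Prod.fst_add, Prod.snd_add, inner_add_left, inner_add_right]
          congr 1
          ring
        simp only [mono_mul_mono, star_mono, star_mul', star_phase, neg_neg, neg_add_rev,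
          Prod.fst_neg, Prod.snd_neg, inner_neg_neg]
        congr 1
        linear_combination (star a * star b) * key
  star_add := WeylPoly.star_add'

theorem smul_mul_assoc' (c : ℂ) (f g : WeylPoly d) : (c • f) * g = c • (f * g) := by
  induction f using ind with
  | h0 => simp
  | hadd f f' hf hf' => simp only [smul_add, add_mul, hf, hf']
  | hm z a =>
    induction g using ind with
    | h0 => simp
    | hadd f f' hf hf' => simp only [smul_add, mul_add, hf, hf']
    | hm w b => simp only [smul_mono, mono_mul_mono, mul_assoc]

theorem mul_smul_comm' (c : ℂ) (f g : WeylPoly d) : f * (c • g) = c • (f * g) := by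
  induction f using ind with
  | h0 => simp
  | hadd f f' hf hf' => simp only [smul_add, add_mul, hf, hf']
  | hm z a =>
    induction g using ind with
    | h0 => simp
    | hadd f f' hf hf' => simp only [smul_add, mul_add, hf, hf']
    | hm w b => simp only [smul_mono, mono_mul_mono, mul_assoc, mul_left_comm a c]

instance : Algebra ℂ (WeylPoly d) := Algebra.ofModule smul_mul_assoc' mul_smul_comm'

instance : StarModule ℂ (WeylPoly d) where
  star_smul c f := by
    induction f using ind with
    | h0 => simp
    | hadd f f' hf hf' => simp only [smul_add, star_add, hf, hf']
    | hm z a => simp only [smul_mono, star_mono, star_mul', mul_assoc]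

/-! ## The minimal regular norm -/

/-- The set of all `‖ρ a‖`, where `ρ` runs over the `*`-representations of the Weyl `*`-algebra by
bounded operators on complex Hilbert spaces. -/
def repNorms (a : WeylPoly d) : Set ℝ :=
  {r | ∃ (H : Type) (_ : NormedAddCommGroup H) (_ : InnerProductSpace ℂ H) (_ : CompleteSpace H)
    (ρ : WeylPoly d →⋆ₐ[ℂ] (H →L[ℂ] H)), r = ‖ρ a‖}

/-- The minimal regular norm `‖a‖ = sup_ρ ‖ρ a‖`. -/
instance : Norm (WeylPoly d) where
  norm a := sSup (repNorms a)

theorem norm_def' (a : WeylPoly d) : ‖a‖ = sSup (repNorms a) := rfl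

theorem star_mono_mul_mono (z : Vec d × Vec d) : star (mono z 1) * mono z 1 = 1 := by
  simp only [star_mono, mono_mul_mono, one_def, Prod.snd_neg, inner_neg_right, neg_neg, star_one,
    one_mul, mul_one, neg_add_cancel, ← phase_add, phase_zero]

theorem bddAbove_repNorms (a : WeylPoly d) : BddAbove (repNorms a) := by
  induction a using ind with
  | h0 =>
    refine ⟨0, ?_⟩
    rintro r ⟨H, _, _, _, ρ, rfl⟩
    simp
  | hadd f g hf hg =>
    obtain ⟨B, hB⟩ := hf
    obtain ⟨C, hC⟩ := hg
    refine ⟨B + C, ?_⟩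
    rintro r ⟨H, i1, i2, i3, ρ, rfl⟩
    rw [map_add]
    exact (norm_add_le _ _).trans
      (add_le_add (hB ⟨H, i1, i2, i3, ρ, rfl⟩) (hC ⟨H, i1, i2, i3, ρ, rfl⟩))
  | hm z a =>
    refine ⟨‖a‖, ?_⟩
    rintro r ⟨H, i1, i2, i3, ρ, rfl⟩
    have h1 : ‖ρ (mono z 1)‖ * ‖ρ (mono z 1)‖ ≤ 1 := by
      rw [← CStarRing.norm_star_mul_self, ← map_star, ← map_mul, star_mono_mul_mono, map_one]
      exact ContinuousLinearMap.norm_id_le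
    have h2 : ‖ρ (mono z 1)‖ ≤ 1 := by nlinarith [norm_nonneg (ρ (mono z 1))]
    have h3 : mono z a = a • mono z 1 := by rw [smul_mono, mul_one]
    rw [h3, map_smul, norm_smul]
    exact mul_le_of_le_one_right (norm_nonneg a) h2

theorem le_norm {H : Type} [NormedAddCommGroup H] [InnerProductSpace ℂ H] [CompleteSpace H]
    (ρ : WeylPoly d →⋆ₐ[ℂ] (H →L[ℂ] H)) (a : WeylPoly d) : ‖ρ a‖ ≤ ‖a‖ :=
  le_csSup (bddAbove_repNorms a) ⟨H, _, _, _, ρ, rfl⟩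

/-- The representation on the zero Hilbert space. -/
def zeroRep : WeylPoly d →⋆ₐ[ℂ] (PUnit.{1} →L[ℂ] PUnit.{1}) where
  toFun _ := 0
  map_one' := Subsingleton.elim _ _
  map_mul' _ _ := Subsingleton.elim _ _
  map_zero' := rfl
  map_add' _ _ := Subsingleton.elim _ _
  commutes' _ := Subsingleton.elim _ _
  map_star' _ := Subsingleton.elim _ _

theorem norm_nonneg' (a : WeylPoly d) : 0 ≤ ‖a‖ := (norm_nonneg _).trans (le_norm zeroRep a)

theorem norm_le {a : WeylPoly d} {C : ℝ}
    (h : ∀ (H : Type) [NormedAddCommGroup H] [InnerProductSpace ℂ H] [CompleteSpace H]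
      (ρ : WeylPoly d →⋆ₐ[ℂ] (H →L[ℂ] H)), ‖ρ a‖ ≤ C) : ‖a‖ ≤ C := by
  refine csSup_le ⟨_, PUnit, inferInstance, inferInstance, inferInstance, zeroRep, rfl⟩ ?_
  rintro r ⟨H, i1, i2, i3, ρ, rfl⟩
  exact h H ρ

theorem norm_zero' : ‖(0 : WeylPoly d)‖ = 0 :=
  le_antisymm (norm_le fun H _ _ _ ρ => by simp) (norm_nonneg' 0)

theorem norm_add_le' (a b : WeylPoly d) : ‖a + b‖ ≤ ‖a‖ + ‖b‖ :=
  norm_le fun H _ _ _ ρ => by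
    rw [map_add]
    exact (norm_add_le _ _).trans (add_le_add (le_norm ρ a) (le_norm ρ b))

theorem norm_neg' (a : WeylPoly d) : ‖-a‖ = ‖a‖ := by
  rw [norm_def', norm_def']
  congr 1
  ext r
  simp only [repNorms, map_neg, norm_neg]

theorem norm_mul_le' (a b : WeylPoly d) : ‖a * b‖ ≤ ‖a‖ * ‖b‖ :=
  norm_le fun H _ _ _ ρ => by
    rw [map_mul]
    exact (norm_mul_le _ _).trans
      (mul_le_mul (le_norm ρ a) (le_norm ρ b) (norm_nonneg _) (norm_nonneg' a))

theorem norm_star' (a : WeylPoly d) : ‖star a‖ = ‖a‖ := by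
  rw [norm_def', norm_def']
  congr 1
  ext r
  simp only [repNorms, map_star, norm_star]

theorem norm_smul_le' (c : ℂ) (a : WeylPoly d) : ‖c • a‖ ≤ ‖c‖ * ‖a‖ :=
  norm_le fun H _ _ _ ρ => by
    rw [map_smul, norm_smul]
    exact mul_le_mul_of_nonneg_left (le_norm ρ a) (norm_nonneg c)

theorem norm_mul_self_le' (a : WeylPoly d) : ‖a‖ * ‖a‖ ≤ ‖star a * a‖ := by
  have h : ‖a‖ ≤ √‖star a * a‖ := norm_le fun H _ _ _ ρ => by
    refine Real.le_sqrt_of_sq_le ?_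
    rw [sq, ← CStarRing.norm_star_mul_self, ← map_star, ← map_mul]
    exact le_norm ρ _
  calc ‖a‖ * ‖a‖ ≤ √‖star a * a‖ * √‖star a * a‖ :=
        mul_self_le_mul_self (norm_nonneg' a) h
    _ = ‖star a * a‖ := Real.mul_self_sqrt (norm_nonneg' _)

instance : SeminormedRing (WeylPoly d) where
  __ := AddGroupSeminorm.toSeminormedAddCommGroup (E := WeylPoly d)
    { toFun := fun a => ‖a‖
      map_zero' := norm_zero'
      add_le' := norm_add_le'
      neg' := norm_neg' }
  __ := (inferInstance : Ring (WeylPoly d))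
  norm_mul_le := norm_mul_le'

instance : NormedAlgebra ℂ (WeylPoly d) where
  norm_smul_le := norm_smul_le'

end WeylPoly

/-! ## The Weyl C*-algebra -/

/-- The Weyl C*-algebra `W` in `d` degrees of freedom: the completion of the Weyl `*`-algebra with
respect to the minimal regular norm. -/
abbrev WeylAlg (d : ℕ) : Type := Completion (WeylPoly d)

namespace WeylAlg

variable {d : ℕ}

theorem isometry_star : Isometry (star : WeylPoly d → WeylPoly d) :=
  AddMonoidHomClass.isometry_of_norm (starAddEquiv : WeylPoly d ≃+ WeylPoly d) WeylPoly.norm_star'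

/-- The involution of `W` is the continuous extension of the involution of `W₀`. -/
instance : Star (WeylAlg d) where
  star := Completion.map star

theorem continuous_star' : Continuous (star : WeylAlg d → WeylAlg d) := Completion.continuous_map

theorem star_coe (a : WeylPoly d) : star (a : WeylAlg d) = ((star a : WeylPoly d) : WeylAlg d) :=
  Completion.map_coe isometry_star.uniformContinuous a

instance : CStarAlgebra (WeylAlg d) where
  __ := (inferInstance : NormedRing (WeylAlg d))
  __ := (inferInstance : Algebra ℂ (WeylAlg d))
  star_involutive x := by
    induction x using Completion.induction_on with
    | hp => exact isClosed_eq (continuous_star'.comp continuous_star') continuous_id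
    | ih a => rw [star_coe, star_coe, star_star]
  star_mul x y := by
    induction x, y using Completion.induction_on₂ with
    | hp =>
      exact isClosed_eq (continuous_star'.comp continuous_mul)
        ((continuous_star'.comp continuous_snd).mul (continuous_star'.comp continuous_fst))
    | ih a b => simp only [star_coe, ← Completion.coe_mul, star_mul]
  star_add x y := by
    induction x, y using Completion.induction_on₂ with
    | hp =>
      exact isClosed_eq (continuous_star'.comp continuous_add)
        ((continuous_star'.comp continuous_fst).add (continuous_star'.comp continuous_snd))
    | ih a b => simp only [star_coe, ← Completion.coe_add, star_add]
  complete := CompleteSpace.complete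
  norm_mul_self_le x := by
    induction x using Completion.induction_on with
    | hp =>
      exact isClosed_le (continuous_norm.mul continuous_norm)
        (continuous_norm.comp (continuous_star'.mul continuous_id))
    | ih a =>
      rw [star_coe, ← Completion.coe_mul, Completion.norm_coe, Completion.norm_coe]
      exact WeylPoly.norm_mul_self_le' a
  norm_smul_le := norm_smul_le
  star_smul c x := by
    induction x using Completion.induction_on with
    | hp =>
      exact isClosed_eq (continuous_star'.comp (continuous_const_smul c))
        (continuous_star'.const_smul (star c))
    | ih a => rw [star_coe, ← Completion.coe_smul, ← Completion.coe_smul, star_coe, star_smul]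

/-- The generator `u_α`. -/
def u (α : Vec d) : WeylAlg d := (WeylPoly.mono (α, 0) 1 : WeylPoly d)

/-- The generator `v_β`. -/
def v (β : Vec d) : WeylAlg d := (WeylPoly.mono (0, β) 1 : WeylPoly d)

/-- The space translation `τ_x(a) = v_x a v_x^*`. -/
def translation (x : Vec d) (a : WeylAlg d) : WeylAlg d := v x * a * star (v x)

/-- The state space of `W`: normalized positive linear functionals, with the weak-* topology
(positive functionals on a C*-algebra are automatically continuous). -/
def states (d : ℕ) : Set (WeakDual ℂ (WeylAlg d)) :=
  {ω | (∀ a, 0 ≤ ω (star a * a)) ∧ ω 1 = 1}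

/-- The set of translation-invariant states, with the weak-* topology. -/
def invStates (d : ℕ) : Set (WeakDual ℂ (WeylAlg d)) :=
  {ω | ω ∈ states d ∧ ∀ (x : Vec d) (a : WeylAlg d), ω (translation x a) = ω a}

end WeylAlg

/-! ## The Bohr compactification of `ℝ^d` -/

/-- The additive group `ℝ^d` with the discrete topology (written multiplicatively). -/
def DiscreteVec (d : ℕ) : Type := Multiplicative (Vec d)

instance (d : ℕ) : CommGroup (DiscreteVec d) := inferInstanceAs (CommGroup (Multiplicative (Vec d)))

instance (d : ℕ) : TopologicalSpace (DiscreteVec d) := ⊥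

instance (d : ℕ) : DiscreteTopology (DiscreteVec d) := ⟨rfl⟩

/-- The Bohr compactification `b(ℝ^d)`: the Pontryagin dual of the dual group `ℝ^d` of `ℝ^d`, taken
with the discrete topology. -/
abbrev Bohr (d : ℕ) : Type := PontryaginDual (DiscreteVec d)

instance (d : ℕ) : MeasurableSpace (Bohr d) := borel _

instance (d : ℕ) : BorelSpace (Bohr d) := ⟨rfl⟩

namespace Bohr

variable {d : ℕ}

/-- The character `ξ_β` of `b(ℝ^d)`, evaluation at `β`. -/
def ξ (β : Vec d) (l : Bohr d) : ℂ := (l (Multiplicative.ofAdd β : Multiplicative (Vec d)) : Circle)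

/-- The canonical map `i : ℝ^d → b(ℝ^d)`, `i(x)(β) = e^{i β·x}`. -/
def incl (x : Vec d) : Bohr d where
  toFun β := Circle.exp (inner ℝ (Multiplicative.toAdd (β : Multiplicative (Vec d))) x)
  map_one' := by
    change Circle.exp (inner ℝ (0 : Vec d) x) = 1
    simp
  map_mul' a b := by
    change Circle.exp (inner ℝ (Multiplicative.toAdd (a : Multiplicative (Vec d)) +
      Multiplicative.toAdd (b : Multiplicative (Vec d))) x) = _
    rw [inner_add_left, Circle.exp_add]
  continuous_toFun := continuous_of_discreteTopology

/-- The image `ℝ^d_b` of `ℝ^d` in `b(ℝ^d)`. -/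
def points (d : ℕ) : Set (Bohr d) := Set.range incl

end Bohr

/-- Regular Borel probability measures on `X`, with the weak-* topology, i.e. the topology of
convergence of the integrals of bounded continuous functions. -/
abbrev RegularProb (X : Type) [TopologicalSpace X] [MeasurableSpace X] : Type :=
  {μ : ProbabilityMeasure X // (μ : Measure X).Regular}

end

/-! The proof rests on the expectation `E = expect` from the Weyl algebra to the continuous
functions on the Bohr compactification, `u_α v_β ↦ δ_{α,0} ξ_{-β}`. At a point `l`, `E` is the
vector functional of `δ_0` in a representation on `ℓ²(ℝ^d)` twisted by `l` (`expectLin_apply`), so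
`E` is contractive and positive. The state of `μ` is `μ ∘ E`.

In the other direction, translation by `x` multiplies `u_α v_β` by `e^{-iα·x}`, so an invariant
state vanishes on `u_α v_β` for `α ≠ 0` and is determined by its values on the `v_β`. Gelfand
duality for the commutative C*-algebra of the `v_β` gives a `*`-homomorphism `ofFun` with `ξ_{-β} ↦
v_β`. Composing a state with it gives a positive functional on continuous functions, and the Riesz
theorem gives `μ`. Since `E ∘ ofFun = id` (Stone–Weierstrass), the two constructions are mutually
inverse. Each is weak-* continuous, because testing one side against an element amounts to testing
the other against its image under `E` or `ofFun`.

For the support statement, suppose the Fourier transform of `μ` is continuous. In a direction `e`,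
the rescaled principal arguments `2^n arg ξ_{2^{-n}e}(l)` are tight, and once they are bounded they
are eventually constant. Hence they converge almost everywhere to a coordinate of a point `x(l)` of
`ℝ^d`. The functions `ξ_b(l)` and `e^{ib·x(l)}` agree almost everywhere for dyadic `b`, so their
integrals agree for all `b` by continuity. Therefore `μ` has the same Fourier transform as the image
in the Bohr compactification of the law of `x`, and the two regular measures coincide. The converse
is dominated convergence. -/

noncomputable section

/-! ### Characters of the Bohr compactification. -/

namespace Bohr

variable {d : ℕ}

theorem ξ_zero (l : Bohr d) : ξ 0 l = 1 := by
  have h : l (1 : DiscreteVec d) = 1 := map_one l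
  exact congrArg (fun z : Circle => (z : ℂ)) h

theorem ξ_add (a b : Vec d) (l : Bohr d) : ξ (a + b) l = ξ a l * ξ b l := by
  have h := map_mul l (Multiplicative.ofAdd a : Multiplicative (Vec d))
    (Multiplicative.ofAdd b : Multiplicative (Vec d))
  exact (congrArg (fun z : Circle => (z : ℂ)) h).trans (Circle.coe_mul _ _)

theorem norm_ξ (b : Vec d) (l : Bohr d) : ‖ξ b l‖ = 1 := Circle.norm_coe _

theorem ξ_neg (b : Vec d) (l : Bohr d) : ξ (-b) l = star (ξ b l) := by
  have h : ξ (-b) l * ξ b l = 1 := by rw [← ξ_add, neg_add_cancel, ξ_zero]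
  rw [eq_inv_of_mul_eq_one_left h, Complex.inv_def, Complex.normSq_eq_norm_sq, norm_ξ]
  simp

theorem ξ_nsmul (k : ℕ) (b : Vec d) (l : Bohr d) : ξ (k • b) l = ξ b l ^ k := by
  induction k with
  | zero => simp [ξ_zero]
  | succ k ih => rw [succ_nsmul, ξ_add, ih, pow_succ]

theorem continuous_ξ (b : Vec d) : Continuous (ξ b : Bohr d → ℂ) :=
  continuous_subtype_val.comp
    (ContinuousEvalConst.continuous_eval_const (F := DiscreteVec d →ₜ* Circle)
      (Multiplicative.ofAdd b : Multiplicative (Vec d)))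

theorem ext_ξ {l m : Bohr d} (h : ∀ b, ξ b l = ξ b m) : l = m :=
  PontryaginDual.ext fun a =>
    Circle.coe_injective (h (Multiplicative.toAdd (a : Multiplicative (Vec d))))

/-- The character `ξ_β` as a continuous function. -/
def char (b : Vec d) : C(Bohr d, ℂ) := ⟨ξ b, continuous_ξ b⟩

@[simp] theorem char_apply (b : Vec d) (l : Bohr d) : char b l = ξ b l := rfl

end Bohr

/-! ### Twisted shift representations on `ℓ²(ℝ^d)` and the expectation on polynomials. -/

namespace WeylPoly

variable {d : ℕ}

theorem norm_phase (t : ℝ) : ‖phase t‖ = 1 := Circle.norm_coe _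

/-- The Hilbert space `ℓ²(ℝ^d)`. -/
abbrev Hil (d : ℕ) : Type := lp (fun _ : Vec d => ℂ) 2

/-- The coefficient of the weighted shift which represents the monomial with index `z`. -/
def shiftCoeff (l : Bohr d) (z : Vec d × Vec d) (γ : Vec d) : ℂ :=
  -- Here `v_β` is multiplication by `e^{-iγ·β} ξ_{-β}(l)` and `u_α` is translation by `α`. In `u_α
  -- v_β` the multiplication acts first, so its symbol is evaluated at `γ - α`.
  phase (-inner ℝ (γ - z.1) z.2) * Bohr.ξ (-z.2) l

theorem norm_shiftCoeff (l : Bohr d) (z : Vec d × Vec d) (γ : Vec d) :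
    ‖shiftCoeff l z γ‖ = 1 := by
  rw [shiftCoeff, norm_mul, norm_phase, Bohr.norm_ξ, mul_one]

/-- The cocycle identity that makes the weighted shifts satisfy the Weyl relations. -/
theorem shiftCoeff_add (l : Bohr d) (z w : Vec d × Vec d) (γ : Vec d) :
    phase (-inner ℝ w.1 z.2) * shiftCoeff l (z + w) γ =
      shiftCoeff l z γ * shiftCoeff l w (γ - z.1) := by
  have h : phase (-inner ℝ w.1 z.2) * phase (-inner ℝ (γ - (z + w).1) (z + w).2) =
      phase (-inner ℝ (γ - z.1) z.2) * phase (-inner ℝ (γ - z.1 - w.1) w.2) := by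
    simp only [← phase_add, Prod.fst_add, Prod.snd_add, inner_add_left, inner_add_right,
      inner_sub_left]
    congr 1
    ring
  simp only [shiftCoeff, Prod.snd_add, neg_add, Bohr.ξ_add] at h ⊢
  linear_combination (Bohr.ξ (-z.2) l * Bohr.ξ (-w.2) l) * h

theorem memℓp_shift (l : Bohr d) (z : Vec d × Vec d) (f : Hil d) :
    Memℓp (fun γ => shiftCoeff l z γ * f (γ - z.1)) 2 := by
  have h := lp.memℓp f
  rw [memℓp_gen_iff (by norm_num)] at h ⊢
  simp only [norm_mul, norm_shiftCoeff, one_mul]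
  exact (Equiv.subRight z.1).summable_iff.mpr h

/-- The weighted shift which represents the monomial with index `z`, as a linear map. -/
def shiftLin (l : Bohr d) (z : Vec d × Vec d) : Hil d →ₗ[ℂ] Hil d where
  toFun f := ⟨fun γ => shiftCoeff l z γ * f (γ - z.1), memℓp_shift l z f⟩
  map_add' f g := by
    ext γ
    change _ * (f (γ - z.1) + g (γ - z.1)) = _ * f (γ - z.1) + _ * g (γ - z.1)
    ring
  map_smul' c f := by
    ext γ
    change _ * (c * f (γ - z.1)) = c * (_ * f (γ - z.1))
    ring

theorem shiftLin_apply (l : Bohr d) (z : Vec d × Vec d) (f : Hil d) (γ : Vec d) :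
    shiftLin l z f γ = shiftCoeff l z γ * f (γ - z.1) := rfl

theorem norm_shiftLin (l : Bohr d) (z : Vec d × Vec d) (f : Hil d) : ‖shiftLin l z f‖ = ‖f‖ := by
  rw [lp.norm_eq_tsum_rpow (by norm_num), lp.norm_eq_tsum_rpow (by norm_num)]
  simp only [shiftLin_apply, norm_mul, norm_shiftCoeff, one_mul]
  rw [← (Equiv.subRight z.1).tsum_eq (fun γ => ‖f γ‖ ^ (2 : ENNReal).toReal)]
  rfl

/-- The weighted shift which represents the monomial with index `z`. -/
def shift (l : Bohr d) (z : Vec d × Vec d) : Hil d →L[ℂ] Hil d :=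
  (⟨shiftLin l z, norm_shiftLin l z⟩ : Hil d →ₗᵢ[ℂ] Hil d).toContinuousLinearMap

theorem shift_apply (l : Bohr d) (z : Vec d × Vec d) (f : Hil d) (γ : Vec d) :
    shift l z f γ = shiftCoeff l z γ * f (γ - z.1) := rfl

theorem shift_zero (l : Bohr d) : shift l 0 = 1 := by
  ext f γ
  rw [shift_apply]
  simp [shiftCoeff, phase_zero, Bohr.ξ_zero]

theorem shift_mul (l : Bohr d) (z w : Vec d × Vec d) :
    shift l z * shift l w = phase (-inner ℝ w.1 z.2) • shift l (z + w) := by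
  ext f γ
  change shiftCoeff l z γ * (shiftCoeff l w (γ - z.1) * f (γ - z.1 - w.1)) =
    phase (-inner ℝ w.1 z.2) * (shiftCoeff l (z + w) γ * f (γ - (z.1 + w.1)))
  rw [sub_sub]
  linear_combination (-f (γ - (z.1 + w.1))) * shiftCoeff_add l z w γ

/-- The shift is an isometry, so its adjoint is a left inverse; the Weyl relations provide an
explicit right inverse, and the two must agree. -/
theorem star_shift (l : Bohr d) (z : Vec d × Vec d) :
    star (shift l z) = phase (-inner ℝ z.1 z.2) • shift l (-z) := by
  have h1 : star (shift l z) * shift l z = 1 :=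
    (ContinuousLinearMap.norm_map_iff_adjoint_comp_self (shift l z)).mp (norm_shiftLin l z)
  have h2 : shift l z * (phase (-inner ℝ z.1 z.2) • shift l (-z)) = 1 := by
    rw [mul_smul_comm, shift_mul, smul_smul, add_neg_cancel, shift_zero, ← phase_add,
      Prod.fst_neg, inner_neg_left, neg_neg, neg_add_cancel, phase_zero, one_smul]
  exact left_inv_eq_right_inv h1 h2

/-- The linear map underlying the representation attached to a point of the Bohr
compactification. -/
def repLin (l : Bohr d) : WeylPoly d →ₗ[ℂ] (Hil d →L[ℂ] Hil d) :=
  Finsupp.linearCombination ℂ (shift l)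

theorem repLin_mono (l : Bohr d) (z : Vec d × Vec d) (a : ℂ) :
    repLin l (mono z a) = a • shift l z :=
  Finsupp.linearCombination_single ℂ a z

theorem repLin_mul (l : Bohr d) (f g : WeylPoly d) :
    repLin l (f * g) = repLin l f * repLin l g := by
  induction f using ind with
  | h0 => simp
  | hadd f f' hf hf' => simp only [add_mul, map_add, hf, hf']
  | hm z a =>
    induction g using ind with
    | h0 => simp
    | hadd f f' hf hf' => simp only [mul_add, map_add, hf, hf']
    | hm w b =>
      rw [mono_mul_mono, repLin_mono, repLin_mono, repLin_mono, smul_mul_assoc, mul_smul_comm,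
        shift_mul, smul_smul, smul_smul, mul_assoc]

theorem repLin_star (l : Bohr d) (f : WeylPoly d) : repLin l (star f) = star (repLin l f) := by
  induction f using ind with
  | h0 => simp
  | hadd f f' hf hf' => simp only [star_add, map_add, hf, hf']
  | hm z a => rw [star_mono, repLin_mono, repLin_mono, star_smul, star_shift, smul_smul]

/-- The representation of the Weyl `*`-algebra on `ℓ²(ℝ^d)` attached to a point of the Bohr
compactification. -/
def rep (l : Bohr d) : WeylPoly d →⋆ₐ[ℂ] (Hil d →L[ℂ] Hil d) :=
  { AlgHom.ofLinearMap (repLin l) (by rw [one_def, repLin_mono, shift_zero, one_smul])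
      (repLin_mul l) with
    map_star' := repLin_star l }

theorem rep_mono (l : Bohr d) (z : Vec d × Vec d) (a : ℂ) :
    rep l (mono z a) = a • shift l z := repLin_mono l z a

/-- The vacuum vector in `ℓ²(ℝ^d)`. -/
def vac (d : ℕ) : Hil d := lp.single 2 0 1

theorem norm_vac : ‖vac d‖ = 1 := by
  rw [vac, lp.norm_single (by norm_num)]
  simp

theorem inner_vac (f : Hil d) : inner ℂ (vac d) f = f 0 := by
  rw [vac, lp.inner_single_left]
  simp

theorem shift_vac (l : Bohr d) (z : Vec d × Vec d) :
    shift l z (vac d) 0 = if z.1 = 0 then Bohr.ξ (-z.2) l else 0 := by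
  rw [shift_apply, vac]
  split_ifs with h
  · simp [shiftCoeff, h, phase_zero]
  · rw [lp.single_apply_ne _ _ _ (by simpa using h), mul_zero]

/-- The value on monomials of the expectation with values in the functions on the Bohr
compactification. -/
def expectMono (z : Vec d × Vec d) : C(Bohr d, ℂ) := if z.1 = 0 then Bohr.char (-z.2) else 0

/-- The expectation `u_α v_β ↦ δ_{α,0} ξ_{-β}` on the Weyl `*`-algebra. -/
def expectLin (d : ℕ) : WeylPoly d →ₗ[ℂ] C(Bohr d, ℂ) :=
  Finsupp.linearCombination ℂ expectMono

theorem expectLin_mono (z : Vec d × Vec d) (a : ℂ) :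
    expectLin d (mono z a) = a • expectMono z :=
  Finsupp.linearCombination_single ℂ a z

/-- A shift by `α ≠ 0` moves `δ_0` to an orthogonal basis vector, so only the terms with `α = 0`
survive. Both the norm bound and the positivity of the expectation follow from this formula. -/
theorem expectLin_apply (f : WeylPoly d) (l : Bohr d) :
    expectLin d f l = inner ℂ (vac d) (rep l f (vac d)) := by
  induction f using ind with
  | h0 => simp
  | hadd f g hf hg => simp [hf, hg]
  | hm z a =>
    rw [expectLin_mono, rep_mono]
    change a * expectMono z l = inner ℂ (vac d) (a • shift l z (vac d))
    rw [inner_smul_right, inner_vac, shift_vac, expectMono]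
    split_ifs <;> rfl

theorem norm_expectLin_le (f : WeylPoly d) : ‖expectLin d f‖ ≤ ‖f‖ := by
  refine (ContinuousMap.norm_le _ (norm_nonneg f)).mpr fun l => ?_
  rw [expectLin_apply]
  refine (norm_inner_le_norm _ _).trans ?_
  rw [norm_vac, one_mul]
  refine (ContinuousLinearMap.le_opNorm _ _).trans ?_
  rw [norm_vac, mul_one]
  exact le_norm (rep l) f

theorem expectLin_star_mul_self (f : WeylPoly d) (l : Bohr d) :
    0 ≤ expectLin d (star f * f) l := by
  rw [expectLin_apply, map_mul, map_star, ContinuousLinearMap.star_eq_adjoint,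
    mul_apply_eq_comp, ContinuousLinearMap.adjoint_inner_right,
    inner_self_eq_norm_sq_to_K]
  positivity

end WeylPoly

/-! ### The expectation on the Weyl C*-algebra. -/

namespace WeylAlg

variable {d : ℕ}

/-- The expectation `u_α v_β ↦ δ_{α,0} ξ_{-β}` on the Weyl C*-algebra. -/
def expect (d : ℕ) : WeylAlg d →L[ℂ] C(Bohr d, ℂ) :=
  ((WeylPoly.expectLin d).mkContinuous 1
    (by simpa using WeylPoly.norm_expectLin_le)).extend Completion.toComplL

theorem expect_coe (f : WeylPoly d) : expect d (f : WeylAlg d) = WeylPoly.expectLin d f := by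
  exact ContinuousLinearMap.extend_eq _ Completion.denseRange_coe
    (Completion.isUniformInducing_coe (WeylPoly d)) f

theorem u_mul_v (α β : Vec d) :
    u α * v β = ((WeylPoly.mono (α, β) 1 : WeylPoly d) : WeylAlg d) := by
  rw [u, v, ← Completion.coe_mul, WeylPoly.mono_mul_mono]
  simp [phase_zero]

theorem u_zero : u (0 : Vec d) = 1 := rfl

theorem v_zero : v (0 : Vec d) = 1 := rfl

theorem v_add (a b : Vec d) : v (a + b) = v a * v b := by
  rw [v, v, v, ← Completion.coe_mul, WeylPoly.mono_mul_mono]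
  simp [phase_zero]

theorem star_v (b : Vec d) : star (v b) = v (-b) := by
  rw [v, v, star_coe, WeylPoly.star_mono]
  simp [phase_zero]

theorem translation_u_mul_v (x α β : Vec d) :
    translation x (u α * v β) = phase (-inner ℝ α x) • (u α * v β) := by
  rw [translation, star_v, u_mul_v, v, v, ← Completion.coe_mul, ← Completion.coe_mul,
    WeylPoly.mono_mul_mono, WeylPoly.mono_mul_mono, ← Completion.coe_smul, WeylPoly.smul_mono]
  simp [phase_zero]

theorem expect_u_mul_v (α β : Vec d) :
    expect d (u α * v β) = if α = 0 then Bohr.char (-β) else 0 := by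
  rw [u_mul_v, expect_coe, WeylPoly.expectLin_mono, one_smul]
  rfl

theorem expect_v (β : Vec d) : expect d (v β) = Bohr.char (-β) := by
  rw [← one_mul (v β), ← u_zero, expect_u_mul_v, if_pos rfl]

theorem expect_one : expect d 1 = 1 := by
  rw [← v_zero, expect_v, neg_zero]
  ext l
  exact Bohr.ξ_zero l

/-- Continuous linear maps on the Weyl algebra agree as soon as they agree on the monomials. -/
theorem ext_of_monomials {F : Type*} [AddCommGroup F] [Module ℂ F] [TopologicalSpace F] [T2Space F]
    {S T : WeylAlg d →L[ℂ] F} (h : ∀ α β, S (u α * v β) = T (u α * v β)) : S = T := by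
  ext a
  induction a using Completion.induction_on with
  | hp => exact isClosed_eq S.continuous T.continuous
  | ih a =>
    induction a using WeylPoly.ind with
    | h0 => rw [Completion.coe_zero, map_zero, map_zero]
    | hadd f g hf hg => rw [Completion.coe_add, map_add, map_add, hf, hg]
    | hm z a =>
      have h' : WeylPoly.mono z a = a • WeylPoly.mono z 1 := by rw [WeylPoly.smul_mono, mul_one]
      rw [h', Completion.coe_smul, map_smul, map_smul, ← u_mul_v, h]

theorem expect_star_mul_self (a : WeylAlg d) (l : Bohr d) : 0 ≤ expect d (star a * a) l := by
  induction a using Completion.induction_on with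
  | hp =>
    refine isClosed_le continuous_const ?_
    have h : Continuous fun a : WeylAlg d => star a * a := continuous_star'.mul continuous_id
    exact (ContinuousEvalConst.continuous_eval_const l).comp ((expect d).continuous.comp h)
  | ih f =>
    rw [star_coe, ← Completion.coe_mul, expect_coe]
    exact WeylPoly.expectLin_star_mul_self f l

/-- The translation by `x` as a continuous linear map. -/
def translationL (x : Vec d) : WeylAlg d →L[ℂ] WeylAlg d :=
  (ContinuousLinearMap.mul ℂ (WeylAlg d)).flip (star (v x)) ∘L ContinuousLinearMap.mul ℂ _ (v x)

theorem translationL_apply (x : Vec d) (a : WeylAlg d) : translationL x a = translation x a := rfl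

theorem expect_translation (x : Vec d) (a : WeylAlg d) :
    expect d (translation x a) = expect d a := by
  have h : (expect d).comp (translationL x) = expect d := by
    refine ext_of_monomials fun α β => ?_
    rw [ContinuousLinearMap.comp_apply, translationL_apply, translation_u_mul_v, map_smul,
      expect_u_mul_v]
    split_ifs with hα
    · simp [hα, phase_zero]
    · rw [smul_zero]
  exact congrArg (fun T => T a) h

/-! ### Gelfand duality for the C*-algebra generated by the `v_β`. -/

open StarAlgebra in
/-- The C*-subalgebra generated by the elements `v_β`. -/
def momentum (d : ℕ) : StarSubalgebra ℂ (WeylAlg d) :=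
  (adjoin ℂ (Set.range (v : Vec d → WeylAlg d))).topologicalClosure

theorem v_comm (a b : Vec d) : v a * v b = v b * v a := by rw [← v_add, ← v_add, add_comm]

/-- The generators commute with each other and with their adjoints `v_{-β}`, and commutativity
passes to the closure. -/
theorem momentum_comm (x y : momentum d) : x * y = y * x := by
  have h : IsMulCommutative (StarAlgebra.adjoin ℂ (Set.range (v : Vec d → WeylAlg d))) := by
    refine StarAlgebra.isMulCommutative_adjoin ℂ ?_ ?_
    · rintro _ ⟨a, rfl⟩ _ ⟨b, rfl⟩
      exact v_comm a b
    · rintro _ ⟨a, rfl⟩ _ ⟨b, rfl⟩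
      rw [star_v]
      exact v_comm a (-b)
  exact (StarSubalgebra.commRingTopologicalClosure _ fun x y =>
    h.is_comm.comm x y).mul_comm x y

instance : CompleteSpace (momentum d) :=
  (StarSubalgebra.isClosed_topologicalClosure _).completeSpace_coe

instance : NormedCommRing (momentum d) :=
  { SubringClass.toNormedRing (momentum d) with
    mul_comm := momentum_comm }

instance : CommCStarAlgebra (momentum d) where

/-- The element `v_β` in the C*-subalgebra which these elements generate. -/
def vm (b : Vec d) : momentum d :=
  ⟨v b, StarSubalgebra.le_topologicalClosure _ (StarAlgebra.subset_adjoin ℂ _ ⟨b, rfl⟩)⟩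

theorem vm_zero : vm (0 : Vec d) = 1 := rfl

theorem vm_add (a b : Vec d) : vm (a + b) = vm a * vm b := Subtype.ext (v_add a b)

theorem star_vm (a : Vec d) : star (vm a) = vm (-a) := Subtype.ext (star_v a)

open WeakDual in
theorem norm_character_vm (φ : characterSpace ℂ (momentum d)) (b : Vec d) : ‖φ (vm b)‖ = 1 := by
  have h : star (φ (vm b)) * φ (vm b) = 1 := by
    rw [← map_star, ← map_mul, star_vm, ← vm_add, neg_add_cancel, vm_zero, map_one]
  have h2 : ‖φ (vm b)‖ * ‖φ (vm b)‖ = 1 := by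
    rw [← CStarRing.norm_star_mul_self, h, norm_one]
  nlinarith [norm_nonneg (φ (vm b))]

open WeakDual in
/-- The point of the Bohr compactification given by a character of the algebra of the `v_β`. -/
def bohrOfCharacter (φ : characterSpace ℂ (momentum d)) : Bohr d where
  -- The sign makes the pullback of `ξ_{-β}` the Gelfand transform of `v_β`.
  toFun b := ⟨φ (vm (-Multiplicative.toAdd (b : Multiplicative (Vec d)))),
    mem_sphere_zero_iff_norm.mpr (norm_character_vm φ _)⟩
  map_one' := Subtype.ext <| by
    change φ (vm (-(0 : Vec d))) = 1
    rw [neg_zero, vm_zero, map_one]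
  map_mul' a b := Subtype.ext <| by
    change φ (vm (-(Multiplicative.toAdd (a : Multiplicative (Vec d)) +
      Multiplicative.toAdd (b : Multiplicative (Vec d))))) = φ (vm _) * φ (vm _)
    rw [neg_add, vm_add, map_mul]
  continuous_toFun := continuous_of_discreteTopology

open WeakDual in
theorem ξ_bohrOfCharacter (φ : characterSpace ℂ (momentum d)) (b : Vec d) :
    Bohr.ξ b (bohrOfCharacter φ) = φ (vm (-b)) := rfl

open WeakDual in
-- Since the group is discrete, the dual carries the topology of pointwise convergence, and each
-- coordinate is a Gelfand transform.
theorem continuous_bohrOfCharacter :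
    Continuous (bohrOfCharacter : characterSpace ℂ (momentum d) → Bohr d) := by
  refine (ContinuousMonoidHom.isClosedEmbedding_coe (A := DiscreteVec d)
    (B := Circle)).isEmbedding.continuous_iff.mpr (continuous_pi fun b => ?_)
  refine Continuous.subtype_mk ?_ _
  exact (gelfandTransform ℂ (momentum d)
    (vm (-Multiplicative.toAdd (b : Multiplicative (Vec d))))).continuous

/-- The `*`-homomorphism from the functions on the Bohr compactification to the Weyl algebra
which maps `ξ_{-β}` to `v_β`. -/
def ofFun (d : ℕ) : C(Bohr d, ℂ) →⋆ₐ[ℂ] WeylAlg d :=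
  ((momentum d).subtype.comp
    ((gelfandStarTransform (momentum d)).symm : _ →⋆ₐ[ℂ] momentum d)).comp
    (ContinuousMap.compStarAlgHom' ℂ ℂ ⟨bohrOfCharacter, continuous_bohrOfCharacter⟩)

theorem ofFun_char (b : Vec d) : ofFun d (Bohr.char (-b)) = v b := by
  have h : (ContinuousMap.compStarAlgHom' ℂ ℂ ⟨bohrOfCharacter, continuous_bohrOfCharacter⟩)
      (Bohr.char (-b)) = gelfandStarTransform (momentum d) (vm b) := by
    ext φ
    change Bohr.ξ (-b) (bohrOfCharacter φ) = φ (vm b)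
    rw [ξ_bohrOfCharacter, neg_neg]
  exact congrArg Subtype.val ((congrArg (gelfandStarTransform (momentum d)).symm h).trans
    (StarAlgEquiv.symm_apply_apply _ _))

/-- The `*`-homomorphism which maps `ξ_{-β}` to `v_β`, as a continuous linear map. -/
def ofFunL (d : ℕ) : C(Bohr d, ℂ) →L[ℂ] WeylAlg d :=
  (ofFun d).toLinearMap.mkContinuous 1 fun f => by
    rw [one_mul]
    exact NonUnitalStarAlgHom.norm_apply_le (ofFun d) f

theorem ofFunL_apply (f : C(Bohr d, ℂ)) : ofFunL d f = ofFun d f := rfl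

end WeylAlg

/-! ### Density of trigonometric polynomials and uniqueness of the Fourier transform. -/

namespace Bohr

variable {d : ℕ}

theorem char_add (a b : Vec d) : char (a + b) = char a * char b := by
  ext l
  exact ξ_add a b l

theorem char_zero : char (0 : Vec d) = 1 := by
  ext l
  exact ξ_zero l

theorem star_char (b : Vec d) : star (char b) = char (-b) := by
  ext l
  exact (ξ_neg b l).symm

/-- Stone–Weierstrass: the characters separate points and are closed under products and conjugation,
so their span is already a `*`-subalgebra. -/
theorem topologicalClosure_span_char :
    (Submodule.span ℂ (Set.range (char : Vec d → C(Bohr d, ℂ)))).topologicalClosure = ⊤ := by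
  let M : Submonoid C(Bohr d, ℂ) :=
    { carrier := Set.range char
      mul_mem' := by
        rintro _ _ ⟨a, rfl⟩ ⟨b, rfl⟩
        exact ⟨a + b, char_add a b⟩
      one_mem' := ⟨0, char_zero⟩ }
  have hM : Submonoid.closure (Set.range (char : Vec d → C(Bohr d, ℂ))) = M :=
    Submonoid.closure_eq M
  let A : StarSubalgebra ℂ C(Bohr d, ℂ) :=
    { toSubalgebra := Algebra.adjoin ℂ (Set.range char)
      star_mem' := by
        change Algebra.adjoin ℂ (Set.range char) ≤ star (Algebra.adjoin ℂ (Set.range char))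
        refine Algebra.adjoin_le ?_
        rintro _ ⟨b, rfl⟩
        exact Algebra.subset_adjoin ⟨-b, (star_char b).symm⟩ }
  have hA : A.topologicalClosure = ⊤ := by
    refine ContinuousMap.starSubalgebra_topologicalClosure_eq_top_of_separatesPoints A ?_
    intro l m hlm
    obtain ⟨b, hb⟩ : ∃ b, ξ b l ≠ ξ b m := by
      by_contra! h
      exact hlm (ext_ξ h)
    exact ⟨_, ⟨char b, Algebra.subset_adjoin ⟨b, rfl⟩, rfl⟩, hb⟩
  have hspan : (Submodule.span ℂ (Set.range (char : Vec d → C(Bohr d, ℂ)))) =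
      Subalgebra.toSubmodule A.toSubalgebra := by
    change _ = Subalgebra.toSubmodule (Algebra.adjoin ℂ (Set.range char))
    rw [Algebra.adjoin_eq_span, hM]
    rfl
  rw [hspan]
  refine eq_top_iff.mpr fun f _ => ?_
  have hf : f ∈ A.topologicalClosure := hA ▸ trivial
  exact hf

/-- Continuous linear maps on the functions on the Bohr compactification agree as soon as they
agree on the characters. -/
theorem ext_of_char {F : Type*} [AddCommGroup F] [Module ℂ F] [TopologicalSpace F] [T2Space F]
    {S T : C(Bohr d, ℂ) →L[ℂ] F} (h : ∀ b, S (char b) = T (char b)) : S = T := by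
  refine ContinuousLinearMap.ext_on (s := Set.range char) ?_ ?_
  · exact Submodule.dense_iff_topologicalClosure_eq_top.mpr topologicalClosure_span_char
  · rintro _ ⟨b, rfl⟩
    exact h b

theorem integrable (f : C(Bohr d, ℂ)) (μ : Measure (Bohr d)) [IsFiniteMeasure μ] :
    Integrable f μ :=
  f.continuous.integrable_of_hasCompactSupport (HasCompactSupport.of_compactSpace _)

/-- Integration against a finite measure on the Bohr compactification. -/
def integralL (μ : Measure (Bohr d)) [IsFiniteMeasure μ] : C(Bohr d, ℂ) →L[ℂ] ℂ :=
  LinearMap.mkContinuous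
    { toFun := fun f => ∫ l, f l ∂μ
      map_add' := fun f g => integral_add (integrable f μ) (integrable g μ)
      map_smul' := fun c f => integral_const_mul c f } (μ.real Set.univ) fun f =>
    (norm_integral_le_of_norm_le_const (.of_forall f.norm_coe_le_norm)).trans_eq (mul_comm _ _)

/-- A real function as a complex function. -/
def ofReal (g : C(Bohr d, ℝ)) : C(Bohr d, ℂ) := ⟨fun l => (g l : ℂ), by fun_prop⟩

/-- Taking `s = √g` turns positivity on elements `a^* a` into positivity on nonnegative functions.
-/
theorem exists_star_mul_self {g : C(Bohr d, ℝ)} (hg : ∀ l, 0 ≤ g l) :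
    ∃ s : C(Bohr d, ℂ), ofReal g = star s * s := by
  refine ⟨ofReal ⟨fun l => √(g l), by fun_prop⟩, ?_⟩
  ext l
  change (g l : ℂ) = star ((√(g l) : ℝ) : ℂ) * ((√(g l) : ℝ) : ℂ)
  rw [Complex.star_def, Complex.conj_ofReal, ← Complex.ofReal_mul, Real.mul_self_sqrt (hg l)]

theorem eq_ofReal_add (f : C(Bohr d, ℂ)) : ∃ g h : C(Bohr d, ℝ),
    f = ofReal g + Complex.I • ofReal h := by
  refine ⟨⟨fun l => (f l).re, by fun_prop⟩, ⟨fun l => (f l).im, by fun_prop⟩, ?_⟩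
  ext l
  change f l = ((f l).re : ℂ) + Complex.I * ((f l).im : ℂ)
  rw [mul_comm, Complex.re_add_im]

/-- Two finite regular measures on the Bohr compactification are equal if they have the same
Fourier transform. -/
theorem measure_ext {μ ν : Measure (Bohr d)} [IsFiniteMeasure μ] [IsFiniteMeasure ν] [μ.Regular]
    [ν.Regular] (h : ∀ b, ∫ l, ξ b l ∂μ = ∫ l, ξ b l ∂ν) : μ = ν := by
  have h1 : integralL μ = integralL ν := ext_of_char h
  refine Measure.ext_of_integral_eq_on_compactlySupported fun f => ?_
  have h2 : ∫ l, ((f l : ℝ) : ℂ) ∂μ = ∫ l, ((f l : ℝ) : ℂ) ∂ν :=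
    congrArg (fun T => T (ofReal f.toContinuousMap)) h1
  exact Complex.ofReal_injective
    (integral_ofReal.symm.trans (h2.trans (integral_ofReal (𝕜 := ℂ))))

theorem regularProb_ext {μ ν : RegularProb (Bohr d)}
    (h : ∀ b, ∫ l, ξ b l ∂(μ.1 : Measure (Bohr d)) = ∫ l, ξ b l ∂(ν.1 : Measure (Bohr d))) :
    μ = ν := by
  have h1 := μ.2
  have h2 := ν.2
  have h3 : (μ.1 : Measure (Bohr d)) = (ν.1 : Measure (Bohr d)) := measure_ext h
  exact Subtype.ext (Subtype.ext h3)

end Bohr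

/-! ### The correspondence between measures and invariant states. -/

namespace WeylAlg

variable {d : ℕ}

open scoped CompactlySupported in
-- The Riesz representation theorem for the functional `ω ∘ ofFun`, applied to its real part on real
-- functions and then extended by complex linearity.
theorem exists_measure {ω : WeakDual ℂ (WeylAlg d)} (hω : ω ∈ states d) :
    ∃ μ : RegularProb (Bohr d), ∀ f : C(Bohr d, ℂ),
      ∫ l, f l ∂(μ.1 : Measure (Bohr d)) = ω (ofFunL d f) := by
  have hpos : ∀ g : C(Bohr d, ℝ), (∀ l, 0 ≤ g l) → 0 ≤ ω (ofFunL d (Bohr.ofReal g)) := by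
    intro g hg
    obtain ⟨s, hs⟩ := Bohr.exists_star_mul_self hg
    rw [hs, ofFunL_apply, map_mul, map_star]
    exact hω.1 _
  have hone : ω (ofFunL d 1) = 1 := by
    rw [ofFunL_apply, map_one]
    exact hω.2
  have hadd : ∀ g h : C(Bohr d, ℝ), Bohr.ofReal (g + h) = Bohr.ofReal g + Bohr.ofReal h := by
    intro g h
    ext l
    exact Complex.ofReal_add _ _
  have hconst : ∀ c : ℝ, Bohr.ofReal (ContinuousMap.const (Bohr d) c) = (c : ℂ) • 1 := by
    intro c
    ext l
    exact (mul_one (c : ℂ)).symm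
  have hreal : ∀ g : C(Bohr d, ℝ),
      (((ω (ofFunL d (Bohr.ofReal g))).re : ℝ) : ℂ) = ω (ofFunL d (Bohr.ofReal g)) := by
    intro g
    -- Adding the constant `‖g‖` makes `g` nonnegative and changes the value of the functional by a
    -- real number, so the original value is real.
    have h1 := hpos (g + ContinuousMap.const _ ‖g‖) fun l => by
      have := abs_le.mp (g.norm_coe_le_norm l)
      change 0 ≤ g l + ‖g‖
      linarith [this.1]
    rw [hadd, hconst, map_add, map_add, map_smul, map_smul, hone] at h1
    have h2 := (Complex.le_def.mp h1).2
    apply Complex.ext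
    · simp
    · simpa using h2
  let Λ : C_c(Bohr d, ℝ) →ₚ[ℝ] ℝ := PositiveLinearMap.mk₀
    { toFun := fun g => (ω (ofFunL d (Bohr.ofReal g.toContinuousMap))).re
      map_add' := fun g h => by
        rw [← Complex.add_re, ← map_add, ← map_add, ← hadd]
        rfl
      map_smul' := fun c g => by
        have h : Bohr.ofReal (c • g).toContinuousMap = (c : ℂ) • Bohr.ofReal g.toContinuousMap := by
          ext l
          exact Complex.ofReal_mul _ _
        rw [h, map_smul, map_smul, smul_eq_mul, Complex.re_ofReal_mul]
        rfl }
    fun g hg => (Complex.le_def.mp (hpos g.toContinuousMap hg)).1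
  have hint : ∀ g : C(Bohr d, ℝ), ∫ l, g l ∂(RealRMK.rieszMeasure Λ) =
      (ω (ofFunL d (Bohr.ofReal g))).re := fun g =>
    RealRMK.integral_rieszMeasure Λ ⟨g, HasCompactSupport.of_compactSpace g⟩
  have hprob : IsProbabilityMeasure (RealRMK.rieszMeasure Λ) := by
    have h := hint (ContinuousMap.const _ 1)
    rw [hconst, Complex.ofReal_one, one_smul, hone] at h
    refine ⟨?_⟩
    have h' : (RealRMK.rieszMeasure Λ).real Set.univ = 1 := by simpa using h
    rw [measureReal_def] at h'
    rw [← ENNReal.ofReal_toReal (measure_ne_top _ _), h', ENNReal.ofReal_one]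
  refine ⟨⟨⟨RealRMK.rieszMeasure Λ, hprob⟩, RealRMK.regular_rieszMeasure Λ⟩, fun f => ?_⟩
  have hof : ∀ g : C(Bohr d, ℝ), Bohr.integralL (RealRMK.rieszMeasure Λ) (Bohr.ofReal g) =
      ω (ofFunL d (Bohr.ofReal g)) := by
    intro g
    rw [← hreal, ← hint]
    exact integral_ofReal
  change Bohr.integralL (RealRMK.rieszMeasure Λ) f = _
  obtain ⟨g, h, rfl⟩ := Bohr.eq_ofReal_add f
  simp only [map_add, map_smul, hof]

/-- The state attached to a probability measure on the Bohr compactification. -/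
def stateOf (μ : RegularProb (Bohr d)) : WeakDual ℂ (WeylAlg d) :=
  (Bohr.integralL (μ.1 : Measure (Bohr d))).comp (expect d)

theorem stateOf_apply (μ : RegularProb (Bohr d)) (a : WeylAlg d) :
    stateOf μ a = ∫ l, expect d a l ∂(μ.1 : Measure (Bohr d)) := rfl

theorem stateOf_mem (μ : RegularProb (Bohr d)) : stateOf μ ∈ invStates d := by
  refine ⟨⟨fun a => ?_, ?_⟩, fun x a => ?_⟩
  · rw [stateOf_apply]
    exact integral_nonneg (expect_star_mul_self a)
  · rw [stateOf_apply, expect_one]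
    simp
  · rw [stateOf_apply, expect_translation, stateOf_apply]

theorem stateOf_u_mul_v (μ : RegularProb (Bohr d)) (α β : Vec d) :
    stateOf μ (u α * v β) =
      if α = 0 then ∫ l, Bohr.ξ (-β) l ∂(μ.1 : Measure (Bohr d)) else 0 := by
  rw [stateOf_apply, expect_u_mul_v]
  split_ifs
  · rfl
  · simp

theorem stateOf_v (μ : RegularProb (Bohr d)) (β : Vec d) :
    stateOf μ (v β) = ∫ l, Bohr.ξ (-β) l ∂(μ.1 : Measure (Bohr d)) := by
  rw [stateOf_apply, expect_v]
  rfl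

theorem apply_u_mul_v_eq_zero {ω : WeakDual ℂ (WeylAlg d)} (hω : ω ∈ invStates d) {α : Vec d}
    (hα : α ≠ 0) (β : Vec d) : ω (u α * v β) = 0 := by
  -- For this translation `α·x = π`, so `u_α v_β` is multiplied by `-1`.
  have h := hω.2 ((Real.pi / ‖α‖ ^ 2) • α) (u α * v β)
  have h0 : ‖α‖ ^ 2 ≠ 0 := pow_ne_zero 2 (norm_ne_zero_iff.mpr hα)
  rw [translation_u_mul_v, map_smul, inner_smul_right, real_inner_self_eq_norm_sq,
    div_mul_cancel₀ _ h0] at h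
  have h1 : phase (-Real.pi) = -1 := by simp [phase, Circle.exp_neg]
  rw [h1, smul_eq_mul] at h
  linear_combination (-1 / 2 : ℂ) * h

theorem expect_ofFunL (f : C(Bohr d, ℂ)) : expect d (ofFunL d f) = f := by
  have h : (expect d).comp (ofFunL d) = ContinuousLinearMap.id ℂ _ := by
    refine Bohr.ext_of_char fun b => ?_
    rw [ContinuousLinearMap.comp_apply, ofFunL_apply, ← neg_neg b, ofFun_char, expect_v]
    rfl
  exact congrArg (fun T => T f) h

/-- The measure attached to an invariant state. -/
def measureOf (ω : invStates d) : RegularProb (Bohr d) := (exists_measure ω.2.1).choose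

theorem integral_measureOf (ω : invStates d) (f : C(Bohr d, ℂ)) :
    ∫ l, f l ∂((measureOf ω).1 : Measure (Bohr d)) = ω.1 (ofFunL d f) :=
  (exists_measure ω.2.1).choose_spec f

theorem stateOf_measureOf (ω : invStates d) : stateOf (measureOf ω) = ω.1 := by
  refine ext_of_monomials (S := stateOf (measureOf ω)) (T := ω.1) fun α β => ?_
  change stateOf (measureOf ω) _ = ω.1 _
  rw [stateOf_u_mul_v]
  split_ifs with hα
  · rw [hα, u_zero, one_mul, ← ofFun_char, ← ofFunL_apply]
    exact integral_measureOf ω (Bohr.char (-β))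
  · exact (apply_u_mul_v_eq_zero ω.2 hα β).symm

theorem measureOf_stateOf (μ : RegularProb (Bohr d)) :
    measureOf ⟨stateOf μ, stateOf_mem μ⟩ = μ := by
  refine Bohr.regularProb_ext fun b => ?_
  refine (integral_measureOf ⟨stateOf μ, stateOf_mem μ⟩ (Bohr.char b)).trans ?_
  change stateOf μ _ = _
  rw [stateOf_apply, expect_ofFunL]
  rfl

theorem continuous_stateOf : Continuous (stateOf : RegularProb (Bohr d) → _) := by
  refine WeakDual.continuous_of_continuous_eval fun a => ?_
  rw [continuous_iff_continuousAt]
  intro μ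
  exact (ProbabilityMeasure.tendsto_iff_forall_integral_rclike_tendsto ℂ).mp
    (continuous_subtype_val.tendsto μ) (BoundedContinuousFunction.mkOfCompact (expect d a))

theorem continuous_measureOf : Continuous (measureOf : invStates d → _) := by
  refine Continuous.subtype_mk
    (ProbabilityMeasure.continuous_iff_forall_continuousMap_continuous_integral.mpr fun g => ?_) _
  have h : ∀ ω : invStates d, ∫ l, g l ∂((measureOf ω).1 : Measure (Bohr d)) =
      (ω.1 (ofFunL d (Bohr.ofReal g))).re := by
    intro ω
    rw [← integral_measureOf]
    exact (congrArg Complex.re (integral_ofReal (f := g))).symm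
  change Continuous fun ω : invStates d => ∫ l, g l ∂((measureOf ω).1 : Measure (Bohr d))
  simp only [h]
  exact Complex.continuous_re.comp ((WeakDual.eval_continuous _).comp continuous_subtype_val)

/-- The homeomorphism between the probability measures on the Bohr compactification and the
invariant states. -/
def stateHomeo (d : ℕ) : RegularProb (Bohr d) ≃ₜ invStates d where
  toFun μ := ⟨stateOf μ, stateOf_mem μ⟩
  invFun := measureOf
  left_inv := measureOf_stateOf
  right_inv ω := Subtype.ext (stateOf_measureOf ω)
  continuous_toFun := continuous_stateOf.subtype_mk _
  continuous_invFun := continuous_measureOf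

end WeylAlg

/-! ### Measures with continuous Fourier transform: recovering a point of `ℝ^d` from a character. -/

namespace Bohr

variable {d : ℕ}

open Filter Topology

theorem phase_eq_exp (t : ℝ) : phase t = Complex.exp (t * Complex.I) := Circle.coe_exp t

theorem continuous_phase : Continuous phase := continuous_subtype_val.comp Circle.exp.continuous

theorem phase_nat_mul (k : ℕ) (t : ℝ) : phase (k * t) = phase t ^ k := by
  rw [phase_eq_exp, phase_eq_exp, ← Complex.exp_nat_mul]
  push_cast
  ring_nf

theorem phase_int_mul (k : ℤ) (t : ℝ) : phase (k * t) = phase t ^ k := by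
  rw [phase_eq_exp, phase_eq_exp, ← Complex.exp_int_mul]
  push_cast
  ring_nf

theorem arg_phase {t : ℝ} (ht : |t| < Real.pi) : (phase t).arg = t :=
  Circle.arg_exp (abs_lt.mp ht).1 (abs_lt.mp ht).2.le

theorem phase_arg {z : ℂ} (hz : ‖z‖ = 1) : phase z.arg = z := by
  have h := Complex.norm_mul_exp_arg_mul_I z
  rw [hz, Complex.ofReal_one, one_mul] at h
  rw [phase_eq_exp, h]

theorem ξ_zsmul (k : ℤ) (b : Vec d) (l : Bohr d) : ξ (k • b) l = ξ b l ^ k := by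
  have h := map_zpow l (Multiplicative.ofAdd b : Multiplicative (Vec d)) k
  exact (congrArg (fun z : Circle => (z : ℂ)) h).trans (Circle.coe_zpow _ _)

theorem ξ_sum {ι : Type*} (s : Finset ι) (b : ι → Vec d) (l : Bohr d) :
    ξ (∑ i ∈ s, b i) l = ∏ i ∈ s, ξ (b i) l := by
  classical
  induction s using Finset.induction_on with
  | empty => simp [ξ_zero]
  | insert i s hi ih => rw [Finset.sum_insert hi, Finset.prod_insert hi, ξ_add, ih]

theorem phase_sum {ι : Type*} (s : Finset ι) (t : ι → ℝ) :
    phase (∑ i ∈ s, t i) = ∏ i ∈ s, phase (t i) := by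
  classical
  induction s using Finset.induction_on with
  | empty => simp [phase_zero]
  | insert i s hi ih => rw [Finset.sum_insert hi, Finset.prod_insert hi, phase_add, ih]

/-- The geometric sum satisfies `|∑ z^k| |z - 1| ≤ 2`, and the chord bound `|z - 1| ≥ (2/π)|arg z|`
then gives `|∑ z^k| ≤ π/|arg z| ≤ N/2`. -/
theorem half_le_sum_one_sub_re {z : ℂ} (hz : ‖z‖ = 1) {N : ℕ} (h : 2 * Real.pi ≤ N * |z.arg|) :
    (N : ℝ) / 2 ≤ ∑ k ∈ Finset.range N, (1 - (z ^ k).re) := by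
  have hpi := Real.pi_pos
  have harg : 0 < |z.arg| := by
    rcases (abs_nonneg z.arg).lt_or_eq with h0 | h0
    · exact h0
    · rw [← h0, mul_zero] at h
      linarith
  have h1 : 2 / Real.pi * |z.arg| ≤ ‖z - 1‖ := by
    have hz0 : z ≠ 0 := norm_ne_zero_iff.mp (by rw [hz]; exact one_ne_zero)
    have := Complex.mul_angle_le_norm_sub hz norm_one
    rwa [Complex.angle_one_right hz0] at this
  have h2 : ‖∑ k ∈ Finset.range N, z ^ k‖ * ‖z - 1‖ ≤ 2 := by
    rw [← norm_mul, geom_sum_mul]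
    refine (norm_sub_le _ _).trans ?_
    rw [norm_pow, hz, one_pow, norm_one]
    norm_num
  have h3 : ‖∑ k ∈ Finset.range N, z ^ k‖ * (2 / Real.pi * |z.arg|) ≤ 2 :=
    (mul_le_mul_of_nonneg_left h1 (norm_nonneg _)).trans h2
  have h4 : ‖∑ k ∈ Finset.range N, z ^ k‖ * |z.arg| ≤ Real.pi := by
    have : ‖∑ k ∈ Finset.range N, z ^ k‖ * |z.arg| =
        ‖∑ k ∈ Finset.range N, z ^ k‖ * (2 / Real.pi * |z.arg|) * (Real.pi / 2) := by
      field_simp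
    rw [this]
    calc _ ≤ 2 * (Real.pi / 2) := by gcongr
      _ = Real.pi := by ring
  have h5 : ‖∑ k ∈ Finset.range N, z ^ k‖ ≤ N / 2 := by
    refine le_of_mul_le_mul_right ?_ harg
    linarith
  have h6 := (Complex.re_le_norm _).trans h5
  rw [Complex.re_sum] at h6
  rw [Finset.sum_sub_distrib]
  simp only [Finset.sum_const, Finset.card_range, nsmul_eq_mul, mul_one]
  linarith

section Measure

variable (μ : Measure (Bohr d)) [IsProbabilityMeasure μ]

theorem integrable_ξ (b : Vec d) : Integrable (ξ b) μ := integrable (char b) μ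

/-- Markov's inequality for `∑_{k<N} (1 - Re ξ_{kb})`, whose mean is at most `Nε` and which is at
least `N/2` on the given set. -/
theorem measureReal_arg_le {b : Vec d} {N : ℕ} {ε : ℝ} (hN : 0 < N)
    (h : ∀ k < N, 1 - (∫ l, ξ (k • b) l ∂μ).re ≤ ε) :
    μ.real {l | 2 * Real.pi ≤ N * |(ξ b l).arg|} ≤ 2 * ε := by
  let f : Bohr d → ℝ := fun l => ∑ k ∈ Finset.range N, (1 - (ξ (k • b) l).re)
  have hint : ∀ k ∈ Finset.range N, Integrable (fun l => 1 - (ξ (k • b) l).re) μ := fun k _ =>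
    (integrable_const 1).sub (integrable_ξ μ (k • b)).re
  have hf : Integrable f μ := integrable_finsetSum _ hint
  have hf0 : 0 ≤ᵐ[μ] f := .of_forall fun l => Finset.sum_nonneg fun k _ => by
    have := (Complex.re_le_norm (ξ (k • b) l)).trans_eq (norm_ξ _ _)
    linarith
  have hle : ∫ l, f l ∂μ ≤ N * ε := by
    rw [integral_finsetSum _ hint]
    calc _ ≤ ∑ k ∈ Finset.range N, ε := by
          refine Finset.sum_le_sum fun k hk => ?_
          have h2 : ∫ l, (1 - (ξ (k • b) l).re) ∂μ = ∫ _, (1 : ℝ) ∂μ - ∫ l, (ξ (k • b) l).re ∂μ :=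
            integral_sub (integrable_const 1) (integrable_ξ μ (k • b)).re
          have h1 : ∫ l, (ξ (k • b) l).re ∂μ = (∫ l, ξ (k • b) l ∂μ).re :=
            integral_re (integrable_ξ μ (k • b))
          rw [h2, integral_const, probReal_univ, one_smul]
          exact (congrArg (1 - ·) h1).trans_le (h k (Finset.mem_range.mp hk))
      _ = N * ε := by simp
  have hmark := mul_meas_ge_le_integral_of_nonneg hf0 hf ((N : ℝ) / 2)
  have hsub : μ.real {l | 2 * Real.pi ≤ N * |(ξ b l).arg|} ≤ μ.real {l | (N : ℝ) / 2 ≤ f l} := by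
    refine measureReal_mono fun l hl => ?_
    have := half_le_sum_one_sub_re (norm_ξ b l) hl
    change (N : ℝ) / 2 ≤ ∑ k ∈ Finset.range N, (1 - (ξ (k • b) l).re)
    simpa only [ξ_nsmul] using this
  have hN' : (0 : ℝ) < N := Nat.cast_pos.mpr hN
  have h7 : (N : ℝ) / 2 * μ.real {l | 2 * Real.pi ≤ N * |(ξ b l).arg|} ≤ N / 2 * (2 * ε) := by
    calc _ ≤ (N : ℝ) / 2 * μ.real {l | (N : ℝ) / 2 ≤ f l} := by gcongr
      _ ≤ N * ε := hmark.trans hle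
      _ = _ := by ring
  exact le_of_mul_le_mul_left h7 (by positivity)

/-- The approximation at scale `2^{-n}` to the coordinate in direction `e`. -/
def coordApprox (e : Vec d) (n : ℕ) (l : Bohr d) : ℝ :=
  2 ^ n * (ξ ((2 ^ n : ℝ)⁻¹ • e) l).arg

theorem measurable_coordApprox (e : Vec d) (n : ℕ) : Measurable (coordApprox e n) :=
  (Complex.measurable_arg.comp (continuous_ξ _).measurable).const_mul _

/-- `ξ_{2^{-m}e}` is the `2^{n-m}`-th power of `ξ_{2^{-n}e}`, and the latter is recovered exactly
from its argument. -/
theorem ξ_eq_phase_coordApprox (e : Vec d) {m n : ℕ} (hmn : m ≤ n) (l : Bohr d) :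
    ξ ((2 ^ m : ℝ)⁻¹ • e) l = phase ((2 ^ m : ℝ)⁻¹ * coordApprox e n l) := by
  obtain ⟨k, rfl⟩ := Nat.exists_eq_add_of_le hmn
  have h1 : (2 ^ m : ℝ)⁻¹ • e = (2 ^ k : ℕ) • ((2 ^ (m + k) : ℝ)⁻¹ • e) := by
    rw [← Nat.cast_smul_eq_nsmul ℝ, smul_smul]
    congr 1
    push_cast
    rw [pow_add]
    field_simp
  have h2 : (2 ^ m : ℝ)⁻¹ * coordApprox e (m + k) l =
      (2 ^ k : ℕ) * (ξ ((2 ^ (m + k) : ℝ)⁻¹ • e) l).arg := by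
    rw [coordApprox]
    push_cast
    rw [pow_add]
    field_simp
  rw [h1, h2, ξ_nsmul, phase_nat_mul, phase_arg (norm_ξ _ _)]

/-- Under this bound the angle at scale `m` computed from level `n` lies in `(-π, π)`, so it is the
principal argument. A bound at a fine level thus fixes the coarser approximations. -/
theorem coordApprox_eq {e : Vec d} {m n : ℕ} (hmn : m ≤ n) {l : Bohr d}
    (h : |coordApprox e n l| < 2 ^ m * Real.pi) : coordApprox e m l = coordApprox e n l := by
  have h2 : (0 : ℝ) < 2 ^ m := by positivity
  rw [coordApprox, ξ_eq_phase_coordApprox e hmn, arg_phase]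
  · field_simp
  · rw [abs_mul, abs_inv, abs_of_pos h2]
    rwa [inv_mul_lt_iff₀ h2]

/-- Tightness uniform in the level: continuity of the Fourier transform at `0` bounds the
probability of a large coordinate. -/
theorem exists_measureReal_coordApprox_le (hμ : Continuous fun b : Vec d => ∫ l, ξ b l ∂μ)
    (e : Vec d) {ε : ℝ} (hε : 0 < ε) :
    ∃ p : ℕ, ∀ n ≥ p, μ.real {l | 2 * Real.pi * 2 ^ p ≤ |coordApprox e n l|} ≤ ε := by
  have hc : Continuous fun t : ℝ => 1 - (∫ l, ξ (t • e) l ∂μ).re :=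
    continuous_const.sub (Complex.continuous_re.comp
      (hμ.comp (continuous_id.smul continuous_const)))
  have h0 : 1 - (∫ l, ξ ((0 : ℝ) • e) l ∂μ).re = 0 := by simp [ξ_zero]
  obtain ⟨δ, hδ, hδ'⟩ := Metric.eventually_nhds_iff.mp
    (hc.tendsto' 0 0 h0 |>.eventually (gt_mem_nhds (half_pos hε)))
  obtain ⟨p, hp⟩ := exists_pow_lt_of_lt_one hδ (by norm_num : (2 : ℝ)⁻¹ < 1)
  refine ⟨p, fun n hn => ?_⟩
  obtain ⟨k, rfl⟩ := Nat.exists_eq_add_of_le hn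
  -- With `n = p + k` and `N = 2^k`, the multiples `j 2^{-n} e` for `j < N` stay within `2^{-p} < δ`
  -- on the line through `e`, while `2π ≤ N |arg|` is exactly the event `2π 2^p ≤ |coordApprox e n
  -- l|`.
  have hm := measureReal_arg_le μ (b := (2 ^ (p + k) : ℝ)⁻¹ • e) (N := 2 ^ k) (ε := ε / 2)
    (by positivity) fun j hj => by
      rw [← Nat.cast_smul_eq_nsmul ℝ, smul_smul]
      refine (hδ' ?_).le
      have hj' : (j : ℝ) ≤ 2 ^ k := by exact_mod_cast hj.le
      rw [Real.dist_eq, sub_zero, abs_of_nonneg (by positivity)]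
      calc (j : ℝ) * (2 ^ (p + k) : ℝ)⁻¹ ≤ 2 ^ k * (2 ^ (p + k) : ℝ)⁻¹ := by gcongr
        _ = 2⁻¹ ^ p := by
          rw [pow_add, inv_pow]
          field_simp
        _ < δ := hp
  rw [mul_div_cancel₀ _ (two_ne_zero)] at hm
  refine le_of_eq_of_le ?_ hm
  congr 1
  ext l
  have h2 : (0 : ℝ) < 2 ^ p := by positivity
  change 2 * Real.pi * 2 ^ p ≤ |coordApprox e (p + k) l| ↔ 2 * Real.pi ≤ (2 ^ k : ℕ) * |_|
  rw [coordApprox, abs_mul, abs_of_pos (by positivity : (0 : ℝ) < 2 ^ (p + k)),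
    show (2 : ℝ) ^ (p + k) = 2 ^ k * 2 ^ p by ring, mul_right_comm (2 ^ k : ℝ),
    mul_le_mul_iff_left₀ h2]
  push_cast
  rfl

theorem ae_tendsto_coordApprox (hμ : Continuous fun b : Vec d => ∫ l, ξ b l ∂μ) (e : Vec d) :
    ∀ᵐ l ∂μ, ∃ x, Tendsto (fun n => coordApprox e n l) atTop (𝓝 x) := by
  rw [ae_iff]
  refine le_antisymm (ENNReal.le_of_forall_pos_le_add fun ε hε _ => ?_) bot_le
  obtain ⟨p, hp⟩ := exists_measureReal_coordApprox_le μ hμ e (NNReal.coe_pos.mpr hε)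
  -- Levels start at `p + 1` because the threshold `2π 2^p` equals `2^{p+1} π`: outside `S n`, all
  -- levels from `p + 1` to `p + 1 + n` agree. Hence the `S n` increase, their union has measure at
  -- most `ε`, and off the union the sequence is eventually constant.
  let S : ℕ → Set (Bohr d) := fun n =>
    {l | 2 * Real.pi * 2 ^ p ≤ |coordApprox e (p + 1 + n) l|}
  have hstab : ∀ m n l, m ≤ n → l ∉ S n → coordApprox e (p + 1 + m) l =
      coordApprox e (p + 1 + n) l := by
    intro m n l hmn hl
    refine coordApprox_eq (by omega) ((not_le.mp hl).trans_le ?_)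
    have h1 : (2 : ℝ) ^ (p + 1) ≤ 2 ^ (p + 1 + m) :=
      pow_le_pow_right₀ one_le_two (by omega)
    calc 2 * Real.pi * 2 ^ p = 2 ^ (p + 1) * Real.pi := by ring
      _ ≤ _ := by gcongr
  have hmono : Monotone S := by
    intro m n hmn l hl
    by_contra hl'
    refine hl' ?_
    have := hstab m n l hmn hl'
    change _ ≤ |coordApprox e (p + 1 + n) l|
    rw [← this]
    exact hl
  have hsub : {l | ¬∃ x, Tendsto (fun n => coordApprox e n l) atTop (𝓝 x)} ⊆ ⋃ n, S n := by
    intro l hl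
    by_contra hl'
    refine hl ⟨coordApprox e (p + 1) l, ?_⟩
    refine tendsto_const_nhds.congr' ?_
    filter_upwards [eventually_ge_atTop (p + 1)] with n hn
    obtain ⟨k, rfl⟩ := Nat.exists_eq_add_of_le hn
    exact hstab 0 k l (Nat.zero_le k) fun h => hl' (Set.mem_iUnion.mpr ⟨k, h⟩)
  refine (measure_mono hsub).trans ?_
  rw [hmono.measure_iUnion, zero_add]
  refine iSup_le fun n => ?_
  have := hp (p + 1 + n) (by omega)
  rw [measureReal_def, ← ENNReal.coe_toReal] at this
  exact (ENNReal.toReal_le_toReal (measure_ne_top _ _) ENNReal.coe_ne_top).mp this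

theorem exists_coord (hμ : Continuous fun b : Vec d => ∫ l, ξ b l ∂μ) (e : Vec d) :
    ∃ x : Bohr d → ℝ, Measurable x ∧
      ∀ᵐ l ∂μ, ∀ m : ℕ, ξ ((2 ^ m : ℝ)⁻¹ • e) l = phase ((2 ^ m : ℝ)⁻¹ * x l) := by
  obtain ⟨x, hx, hlim⟩ := measurable_limit_of_tendsto_metrizable_ae (L := atTop)
    (fun n => (measurable_coordApprox e n).aemeasurable) (ae_tendsto_coordApprox μ hμ e)
  refine ⟨x, hx, ?_⟩
  filter_upwards [hlim] with l hl m
  have h1 : Tendsto (fun n => phase ((2 ^ m : ℝ)⁻¹ * coordApprox e n l)) atTop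
      (𝓝 (phase ((2 ^ m : ℝ)⁻¹ * x l))) :=
    (continuous_phase.tendsto _).comp (hl.const_mul _)
  refine tendsto_nhds_unique (tendsto_const_nhds.congr' ?_) h1
  filter_upwards [eventually_ge_atTop m] with n hn
  exact ξ_eq_phase_coordApprox e hn l

/-- The dyadic approximation of a vector. -/
def dyadic (b : Vec d) (m : ℕ) : Vec d :=
  ∑ j, ⌊2 ^ m * b j⌋ • ((2 ^ m : ℝ)⁻¹ • EuclideanSpace.single j (1 : ℝ))

theorem tendsto_dyadic (b : Vec d) : Tendsto (dyadic b) atTop (𝓝 b) := by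
  have h : b = ∑ j, b j • EuclideanSpace.single j (1 : ℝ) := by
    ext i
    simp [Pi.single_apply]
  nth_rw 2 [h]
  refine tendsto_finsetSum _ fun j _ => ?_
  have h1 : Tendsto (fun m : ℕ => (⌊b j * 2 ^ m⌋ : ℝ) / 2 ^ m) atTop (𝓝 (b j)) := by
    have h2 : Tendsto (fun m : ℕ => Int.fract (b j * 2 ^ m) * (2⁻¹ : ℝ) ^ m) atTop (𝓝 0) :=
      squeeze_zero (fun m => mul_nonneg (Int.fract_nonneg _) (by positivity))
        (fun m => mul_le_of_le_one_left (by positivity) (Int.fract_lt_one _).le)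
        (tendsto_pow_atTop_nhds_zero_of_lt_one (by norm_num) (by norm_num))
    have h3 := (tendsto_const_nhds (x := b j)).sub h2
    rw [sub_zero] at h3
    refine h3.congr fun m => ?_
    rw [Int.fract, inv_pow]
    field_simp
    ring
  refine (h1.smul_const (EuclideanSpace.single j (1 : ℝ))).congr fun m => ?_
  rw [← Int.cast_smul_eq_zsmul ℝ, smul_smul, mul_comm (b j), div_eq_mul_inv]

theorem continuous_integral_phase {Ω : Type*} [MeasurableSpace Ω] (P : Measure Ω)
    [IsFiniteMeasure P] {x : Ω → Vec d} (hx : Measurable x) :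
    Continuous fun b : Vec d => ∫ t, phase (inner ℝ b (x t)) ∂P := by
  refine continuous_of_dominated (bound := fun _ => 1) (fun b => ?_) (fun b => ?_)
    (integrable_const 1) (.of_forall fun t => ?_)
  · exact (continuous_phase.measurable.comp (measurable_const.inner hx)).aestronglyMeasurable
  · exact .of_forall fun t => (WeylPoly.norm_phase _).le
  · exact continuous_phase.comp (continuous_id.inner continuous_const)

theorem exists_coordVec (hμ : Continuous fun b : Vec d => ∫ l, ξ b l ∂μ) :
    ∃ x : Bohr d → Vec d, Measurable x ∧
      ∀ b, ∫ l, ξ b l ∂μ = ∫ l, phase (inner ℝ b (x l)) ∂μ := by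
  choose x hx hx' using fun j : Fin d => exists_coord μ hμ (EuclideanSpace.single j 1)
  let y : Bohr d → Vec d := fun l => WithLp.toLp 2 fun j => x j l
  have hy : Measurable y :=
    (WithLp.measurable_toLp 2 _).comp (measurable_pi_lambda _ hx)
  refine ⟨y, hy, fun b => ?_⟩
  -- A dyadic vector is an integer combination of the vectors `2^{-m} e_j`, so multiplicativity
  -- carries the coordinate identities over to it.
  have hd : ∀ m, ∫ l, ξ (dyadic b m) l ∂μ = ∫ l, phase (inner ℝ (dyadic b m) (y l)) ∂μ := by
    intro m
    refine integral_congr_ae ?_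
    filter_upwards [ae_all_iff.mpr hx'] with l hl
    rw [dyadic, ξ_sum, sum_inner, phase_sum]
    refine Finset.prod_congr rfl fun j _ => ?_
    rw [ξ_zsmul, hl, ← phase_int_mul, ← Int.cast_smul_eq_zsmul ℝ, inner_smul_left, inner_smul_left,
      EuclideanSpace.inner_single_left]
    simp [y]
  -- Both Fourier transforms are continuous in `b`, so agreement along dyadic approximations
  -- suffices.
  refine tendsto_nhds_unique ((hμ.tendsto b).comp (tendsto_dyadic b)) ?_
  refine (((continuous_integral_phase μ hy).tendsto b).comp (tendsto_dyadic b)).congr fun m => ?_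
  exact (hd m).symm

end Measure

/-! ### Measures carried by the image of `ℝ^d`. -/

theorem continuous_incl : Continuous (incl : Vec d → Bohr d) := by
  refine (ContinuousMonoidHom.isClosedEmbedding_coe (A := DiscreteVec d)
    (B := Circle)).isEmbedding.continuous_iff.mpr (continuous_pi fun b => ?_)
  exact Circle.exp.continuous.comp (continuous_const.inner continuous_id)

/-- `ℝ^d` is σ-compact, so its continuous image is a countable union of compact, hence closed, sets.
-/
theorem measurableSet_points : MeasurableSet (points d) := by
  obtain ⟨K, hK, h⟩ := isSigmaCompact_range (continuous_incl (d := d))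
  rw [points, ← h]
  exact .iUnion fun n => (hK n).isClosed.measurableSet

/-- Dominated convergence: at almost every `l` the map `b ↦ ξ_b(l)` has the form `e^{ib·x}`. -/
theorem continuous_integral_ξ (μ : Measure (Bohr d)) [IsProbabilityMeasure μ]
    (h : μ (points d)ᶜ = 0) : Continuous fun b : Vec d => ∫ l, ξ b l ∂μ := by
  refine continuous_of_dominated (bound := fun _ => 1)
    (fun b => (integrable_ξ μ b).aestronglyMeasurable)
    (fun b => .of_forall fun l => (norm_ξ b l).le) (integrable_const 1) ?_
  filter_upwards [mem_ae_iff.mpr h] with l hl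
  obtain ⟨x, rfl⟩ := hl
  exact continuous_phase.comp (continuous_id.inner continuous_const)

theorem integral_map_incl (ν : Measure (Vec d)) (b : Vec d) :
    ∫ l, ξ b l ∂(ν.map incl) = ∫ x, phase (inner ℝ b x) ∂ν :=
  integral_map continuous_incl.measurable.aemeasurable (continuous_ξ b).aestronglyMeasurable

theorem exists_map_incl_eq (μ : RegularProb (Bohr d))
    (h : Continuous fun b : Vec d => ∫ l, ξ b l ∂(μ.1 : Measure (Bohr d))) :
    ∃ ν : RegularProb (Vec d), (ν.1 : Measure (Vec d)).map incl = (μ.1 : Measure (Bohr d)) := by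
  obtain ⟨x, hx, hint⟩ := exists_coordVec (μ.1 : Measure (Bohr d)) h
  have h1 : IsProbabilityMeasure ((μ.1 : Measure (Bohr d)).map x) :=
    Measure.isProbabilityMeasure_map hx.aemeasurable
  have h2 : IsProbabilityMeasure (((μ.1 : Measure (Bohr d)).map x).map incl) :=
    Measure.isProbabilityMeasure_map continuous_incl.measurable.aemeasurable
  -- Equality of Fourier transforms identifies only regular measures; regularity of the image comes
  -- from inner regularity on `ℝ^d` and continuity of `incl`.
  have h3 : (((μ.1 : Measure (Bohr d)).map x).map incl).InnerRegular :=
    Measure.InnerRegular.map_of_continuous continuous_incl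
  have h4 := μ.2
  have h5 : ((μ.1 : Measure (Bohr d)).map x).Regular := inferInstance
  refine ⟨⟨⟨_, h1⟩, h5⟩, ?_⟩
  change ((μ.1 : Measure (Bohr d)).map x).map incl = _
  refine measure_ext fun b => ?_
  rw [hint]
  refine (integral_map_incl _ b).trans (integral_map hx.aemeasurable ?_)
  exact (continuous_phase.comp (continuous_const.inner continuous_id)).aestronglyMeasurable

/-- Integrating `ξ_b` against the image measure gives the characteristic function of the original
measure on `ℝ^d`, which determines it. -/
theorem regularProb_vec_ext {ν ν' : RegularProb (Vec d)}
    (h : (ν.1 : Measure (Vec d)).map incl = (ν'.1 : Measure (Vec d)).map incl) : ν = ν' := by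
  have h1 : (ν.1 : Measure (Vec d)) = (ν'.1 : Measure (Vec d)) := by
    refine Measure.ext_of_charFun ?_
    ext b
    have h2 := integral_map_incl (ν.1 : Measure (Vec d)) b
    rw [h, integral_map_incl] at h2
    simp only [charFun_apply, real_inner_comm b, ← phase_eq_exp]
    simpa only [real_inner_comm b] using h2.symm
  exact Subtype.ext (Subtype.ext h1)

theorem continuous_integral_ξ_iff (μ : RegularProb (Bohr d)) :
    (Continuous fun b : Vec d => ∫ l, ξ b l ∂(μ.1 : Measure (Bohr d))) ↔
      (μ.1 : Measure (Bohr d)) (points d)ᶜ = 0 := by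
  refine ⟨fun h => ?_, continuous_integral_ξ _⟩
  obtain ⟨ν, hν⟩ := exists_map_incl_eq μ h
  rw [← hν, Measure.map_apply continuous_incl.measurable measurableSet_points.compl]
  have h0 : incl ⁻¹' (points d)ᶜ = ∅ := by
    ext x
    simp [points]
  rw [h0, measure_empty]

end Bohr
end

theorem mainTheorem5 (d : ℕ) :
    ∃ Φ : RegularProb (Bohr d) ≃ₜ WeylAlg.invStates d,
      -- the formula for the state `ω = Φ μ`, which determines `ω` among all states
      (∀ (μ : RegularProb (Bohr d)) (α β : Vec d),
        (Φ μ).1 (WeylAlg.u α * WeylAlg.v β) =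
          if α = 0 then ∫ l, Bohr.ξ (-β) l ∂(μ.1 : Measure (Bohr d)) else 0) ∧
      (∀ (μ : RegularProb (Bohr d)), ∀ ω ∈ WeylAlg.states d,
        (∀ α β : Vec d, ω (WeylAlg.u α * WeylAlg.v β) =
          if α = 0 then ∫ l, Bohr.ξ (-β) l ∂(μ.1 : Measure (Bohr d)) else 0) →
        ω = (Φ μ).1) ∧
      -- continuity in `β` means that `μ` is carried by `ℝ^d`
      (∀ μ : RegularProb (Bohr d),
        (Continuous fun β : Vec d => (Φ μ).1 (WeylAlg.v β)) ↔
          (μ.1 : Measure (Bohr d)) (Bohr.points d)ᶜ = 0) ∧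
      -- in that case `μ` comes from a unique regular probability measure on `ℝ^d`
      (∀ μ : RegularProb (Bohr d), (μ.1 : Measure (Bohr d)) (Bohr.points d)ᶜ = 0 →
        ∃ ν : RegularProb (Vec d),
          (∀ ν' : RegularProb (Vec d),
            (∀ B : Set (Bohr d), MeasurableSet B →
              (ν'.1 : Measure (Vec d)) (Bohr.incl ⁻¹' B) = (μ.1 : Measure (Bohr d)) B) ↔
            ν' = ν) ∧
          ∀ α β : Vec d, (Φ μ).1 (WeylAlg.u α * WeylAlg.v β) =
            if α = 0 then ∫ x, Complex.exp (-(Complex.I * (inner ℝ x β : ℝ)))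
              ∂(ν.1 : Measure (Vec d)) else 0) := by
  refine ⟨WeylAlg.stateHomeo d, WeylAlg.stateOf_u_mul_v, fun μ ω _ h => ?_, fun μ => ?_,
    fun μ h => ?_⟩
  · exact WeylAlg.ext_of_monomials (S := ω) (T := WeylAlg.stateOf μ) fun α β =>
      (h α β).trans (WeylAlg.stateOf_u_mul_v μ α β).symm
  · rw [← Bohr.continuous_integral_ξ_iff]
    have h1 : (fun β : Vec d => (WeylAlg.stateHomeo d μ).1 (WeylAlg.v β)) =
        fun β => ∫ l, Bohr.ξ (-β) l ∂(μ.1 : Measure (Bohr d)) :=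
      funext (WeylAlg.stateOf_v μ)
    rw [h1]
    -- The state sees the Fourier transform at `-β`; reflection in `β` does not affect continuity.
    refine ⟨fun h => ?_, fun h => h.comp continuous_neg⟩
    simpa only [Function.comp_def, neg_neg] using h.comp continuous_neg
  · obtain ⟨ν, hν⟩ := Bohr.exists_map_incl_eq μ ((Bohr.continuous_integral_ξ_iff μ).mpr h)
    have hm := (Bohr.continuous_incl (d := d)).measurable
    refine ⟨ν, fun ν' => ⟨fun h' => ?_, ?_⟩, fun α β => ?_⟩
    -- The condition on all Borel sets says that the image of `ν'` under `incl` is `μ`.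
    · refine Bohr.regularProb_vec_ext (Eq.trans ?_ hν.symm)
      ext B hB
      rw [Measure.map_apply hm hB, h' B hB]
    · rintro rfl B hB
      rw [← hν, Measure.map_apply hm hB]
    · refine (WeylAlg.stateOf_u_mul_v μ α β).trans ?_
      rw [← hν, Bohr.integral_map_incl]
      simp only [Bohr.phase_eq_exp, inner_neg_left, real_inner_comm, Complex.ofReal_neg, neg_mul,
        mul_comm Complex.I]
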